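/- Let $V$ be a countable set, let $\mathfrak h_i$ ($i\in V$) be separable complex Hilbert spaces, and let $\mathcal H=\bigoplus_{i\in V}\mathfrak h_i$ (Hilbert sum); for $x\in\mathfrak h_i$ write $x\otimes\vec i$ for $x$ viewed as a vector of $\mathcal H$. Let $\mathfrak M$ be an open quantum random walk on $\mathcal H$: $\mathfrak M(\rho)=\sum_{i,j\in V}A_{i,j}\,\rho\,A_{i,j}^*$ for $\rho$ trace class, where $A_{i,j}=L_{i,j}\otimes|i\rangle\langle j|$, the $L_{i,j}:\mathfrak h_j\to\mathfrak h_i$ are bounded, and $\sum_{i\in V}L_{i,j}^*L_{i,j}=\mathrm{Id}$ strongly for every $j\in V$. An enclosure is a closed subspace $\mathcal V\subset\mathcal H$ such that $\mathrm{supp}\,\rho\subset\mathcal V$ implies $\mathrm{supp}\,\mathfrak M(\rho)\subset\mathcal V$ for every positive trace-class $\rho$; a minimal enclosure is a nonzero enclosure that contains no enclosure other than $\{0\}$ and itself. A path from $i$ to $j$ is a finite sequence $\pi=(i_0,\dots,i_\ell)$ in $V$, $\ell\ge 0$, with $i_0=i$, $i_\ell=j$; put $L_\pi=L_{i_\ell,i_{\ell-1}}\cdots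 L_{i_1,i_0}$, with $L_\pi=\mathrm{Id}$ if $\ell=0$. For $\phi\in\mathcal H$ let $\mathrm{Enc}(\phi)$ be the closed linear span of the vectors $(L_\pi\otimes|j\rangle\langle i|)\,\phi$ over all $i,j\in V$ and all paths $\pi$ from $i$ to $j$. Write $\phi\leftrightarrow\psi$ if $\psi\in\mathrm{Enc}(\phi)$ and $\phi\in\mathrm{Enc}(\psi)$. A state is a positive trace-class operator of trace one; it is invariant if $\mathfrak M(\rho)=\rho$. Let $\mathcal R$ be the closed linear span of the supports of all invariant states, and let $\mathcal D=\mathcal R^\perp$. Then there are at most countable sets $A$, $B$ and $C_\beta$ ($\beta\in B$), with every $C_\beta$ of cardinality at least two, and vectors $x_\alpha\in\mathfrak h_{i_\alpha}$ ($\alpha\in A$) and $x_{\beta,\gamma}\in\mathfrak h_{i_{\beta,\gamma}}$ ($\beta\in B$, $\gamma\in C_\beta$), giving an orthogonal (Hilbert) direct sum decomposition $$\mathcal H=\mathcal D\oplus\bigoplus_{\alpha\in A}\mathrm{Enc}(x_\alpha\otimes\vec{i_\alpha})\oplus\bigoplus_{\beta\in B}\bigoplus_{\gamma\in C_\beta}\mathrm{Enc}(x_{\beta,\gamma}\otimes\vec{i_{\beta,\gamma}})$$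 such that: - $A$ and $B$ are not both empty if and only if $\mathfrak M$ has an invariant state; - every $E=\mathrm{Enc}(x_\alpha\otimes\vec{i_\alpha})$ and every $E=\mathrm{Enc}(x_{\beta,\gamma}\otimes\vec{i_{\beta,\gamma}})$ is a minimal enclosure, and $E\setminus\{0\}$ is an equivalence class for $\leftrightarrow$; - for $\alpha\in A$, the only minimal enclosure not orthogonal to $\mathrm{Enc}(x_\alpha\otimes\vec{i_\alpha})$ is $\mathrm{Enc}(x_\alpha\otimes\vec{i_\alpha})$ itself; - for $\beta\in B$ and $\gamma\in C_\beta$, every minimal enclosure not orthogonal to $\mathrm{Enc}(x_{\beta,\gamma}\otimes\vec{i_{\beta,\gamma}})$ is contained in $\bigoplus_{\gamma'\in C_\beta}\mathrm{Enc}(x_{\beta,\gamma'}\otimes\vec{i_{\beta,\gamma'}})$. -/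

import Mathlib

noncomputable section

universe u v

/-- A path `i₀, i₁, …, i_ℓ` in `V` from `i = i₀` to `j = i_ℓ` (any finite sequence of sites is
allowed); `SitePath.nil` is the one-term sequence `i`, and `π.snoc k` appends the site `k`. -/
inductive SitePath {V : Type u} (i : V) : V → Type u
  | nil : SitePath i i
  | snoc {j : V} (π : SitePath i j) (k : V) : SitePath i k

section TraceClass

variable {E : Type v} [NormedAddCommGroup E] [InnerProductSpace ℂ E] [CompleteSpace E]

/-- `T` is trace class: `∑ ⟨b, |T| b⟩ < ∞` in every Hilbert basis, where `|T| = √(T† T)`. -/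
def IsTraceClass (T : E →L[ℂ] E) : Prop :=
  ∀ (w : Set E) (b : HilbertBasis w ℂ E), Summable fun e : w => inner ℂ (b e) (CFC.abs T (b e))

/-- A state: a positive trace-class operator of trace one. -/
def IsState (ρ : E →L[ℂ] E) : Prop :=
  ρ.IsPositive ∧ IsTraceClass ρ ∧
    ∀ (w : Set E) (b : HilbertBasis w ℂ E), HasSum (fun e : w => inner ℂ (b e) (ρ (b e))) 1

/-- The support of a (positive) operator: the orthogonal complement of its kernel. -/
def opSupport (ρ : E →L[ℂ] E) : Submodule ℂ E := (LinearMap.ker ρ.toLinearMap)ᗮ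

end TraceClass

/-- The Hilbert space `⨁ i, h i` (Hilbert sum) of an open quantum random walk. -/
abbrev WalkSpace {V : Type u} (h : V → Type v) [∀ i, NormedAddCommGroup (h i)] : Type (max u v) :=
  lp h 2

/-- An open quantum random walk on `⨁ i, h i`: transition operators `L i j : h j → h i` with
`∑ i, (L i j)† (L i j) = 1` for every `j`, the series converging strongly. -/
structure OQRW {V : Type u} (h : V → Type v) [∀ i, NormedAddCommGroup (h i)]
    [∀ i, InnerProductSpace ℂ (h i)] [∀ i, CompleteSpace (h i)] where
  L : ∀ i j : V, h j →L[ℂ] h i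
  stochastic : ∀ (j : V) (x : h j),
    HasSum (fun i => ContinuousLinearMap.adjoint (L i j) (L i j x)) x

namespace OQRW

variable {V : Type u} {h : V → Type v} [∀ i, NormedAddCommGroup (h i)]
  [∀ i, InnerProductSpace ℂ (h i)] [∀ i, CompleteSpace (h i)]

open Classical in
/-- For `T : h i → h j`, the operator `T ⊗ |j⟩⟨i|` on `⨁ i, h i`. -/
def block {i j : V} (T : h i →L[ℂ] h j) : WalkSpace h →L[ℂ] WalkSpace h :=
  (lp.singleContinuousLinearMap ℂ h 2 j).comp (T.comp (lp.evalCLM ℂ h 2 i))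

open Classical in
/-- For `x` in `h i`, the vector `x ⊗ i` of `⨁ i, h i`. -/
def site (i : V) (x : h i) : WalkSpace h := lp.single 2 i x

/-- The Kraus operators `A i j = L i j ⊗ |i⟩⟨j|`. -/
def kraus (M : OQRW h) (i j : V) : WalkSpace h →L[ℂ] WalkSpace h := block (M.L i j)

/-- The map `ρ ↦ ∑ i j, A i j ρ (A i j)†` on trace-class operators. For trace-class `ρ` the series
converges absolutely in trace norm, hence in operator norm; the latter is the topology of the
sum here. Only the values at trace-class `ρ` are ever used. -/
def map (M : OQRW h) (ρ : WalkSpace h →L[ℂ] WalkSpace h) : WalkSpace h →L[ℂ] WalkSpace h :=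
  ∑' p : V × V, (M.kraus p.1 p.2).comp
    (ρ.comp (ContinuousLinearMap.adjoint (M.kraus p.1 p.2)))

/-- `L_π = L_{i_ℓ, i_{ℓ-1}} ⋯ L_{i₁, i₀}`, the identity for a one-term path. -/
def pathOp (M : OQRW h) {i : V} : {j : V} → SitePath i j → (h i →L[ℂ] h j)
  | _, SitePath.nil => ContinuousLinearMap.id ℂ (h i)
  | _, SitePath.snoc (j := j) π k => (M.L k j).comp (M.pathOp π)

/-- An enclosure: a closed subspace `W` such that `supp ρ ⊆ W` implies `supp M(ρ) ⊆ W`, for every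
positive trace-class operator `ρ`. -/
def IsEnclosure (M : OQRW h) (W : Submodule ℂ (WalkSpace h)) : Prop :=
  IsClosed (W : Set (WalkSpace h)) ∧
    ∀ ρ : WalkSpace h →L[ℂ] WalkSpace h, ρ.IsPositive → IsTraceClass ρ →
      opSupport ρ ≤ W → opSupport (M.map ρ) ≤ W

/-- A minimal enclosure: a nonzero enclosure containing no enclosure but `0` and itself. -/
def IsMinimalEnclosure (M : OQRW h) (W : Submodule ℂ (WalkSpace h)) : Prop :=
  M.IsEnclosure W ∧ W ≠ ⊥ ∧ ∀ W', M.IsEnclosure W' → W' ≤ W → W' = ⊥ ∨ W' = W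

/-- `Enc(φ)`: the closed linear span of the vectors `(L_π ⊗ |j⟩⟨i|) φ`, over all sites `i`, `j`
and all paths `π` from `i` to `j`. -/
def enc (M : OQRW h) (φ : WalkSpace h) : Submodule ℂ (WalkSpace h) :=
  (Submodule.span ℂ
    {ψ | ∃ (i j : V) (π : SitePath i j), ψ = block (M.pathOp π) φ}).topologicalClosure

/-- `φ` and `ψ` are accessible from each other. -/
def Communicates (M : OQRW h) (φ ψ : WalkSpace h) : Prop :=
  ψ ∈ M.enc φ ∧ φ ∈ M.enc ψ

/-- `S` is an equivalence class of mutual accessibility. -/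
def IsCommunicationClass (M : OQRW h) (S : Set (WalkSpace h)) : Prop :=
  S.Nonempty ∧ ∀ φ ∈ S, ∀ ψ, M.Communicates φ ψ ↔ ψ ∈ S

/-- A state `ρ` with `M(ρ) = ρ`. -/
def IsInvariantState (M : OQRW h) (ρ : WalkSpace h →L[ℂ] WalkSpace h) : Prop :=
  IsState ρ ∧ M.map ρ = ρ

/-- The fast recurrent space `R`: the smallest closed subspace containing the supports of all
invariant states. -/
def fastRecurrent (M : OQRW h) : Submodule ℂ (WalkSpace h) :=
  (⨆ (ρ : WalkSpace h →L[ℂ] WalkSpace h) (_ : M.IsInvariantState ρ),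
    opSupport ρ).topologicalClosure

/-- The space `D = Rᗮ`. -/
def decaying (M : OQRW h) : Submodule ℂ (WalkSpace h) := M.fastRecurrentᗮ

end OQRW

/-- `E` is the orthogonal (Hilbert) direct sum of the family of subspaces `F`. -/
def IsOrthogonalDecomposition {ι : Type*} {E : Type*} [NormedAddCommGroup E]
    [InnerProductSpace ℂ E] [CompleteSpace E] (F : ι → Submodule ℂ E) : Prop :=
  (∀ k, IsClosed (F k : Set E)) ∧ IsHilbertSum ℂ (fun k => F k) (fun k => (F k).subtypeₗᵢ)

end

/-! Most of the argument uses only Kraus operators `K p` with `∑ (K p)† (K p) = 1`. Testing on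
rank-one operators identifies enclosures with closed subspaces invariant under every `K p`.
Trace-class arguments are carried by decompositions `ρ = ∑ |r b⟩⟨r b|` (`Represents`).

The key is `Represents.commute_of_hasSum`: for invariant `ρ`, trace preservation forces suitable
operators `X` to commute with all `K p` on `supp ρ`. With `X` the projection onto an enclosure `W`,
this makes the compression of an invariant state to `W` invariant up to normalization, and makes `R
⊓ Wᗮ` an enclosure.

Minimal enclosures must be found without any finite dimensionality. A weak limit of Cesàro means of
the dual map, started at `|v⟩⟨v|`, is a fixed point `X` with `tr(ρ X) = ⟨v, ρ v⟩` for every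
invariant `ρ`. Its compression to a support also commutes with the `K p` there, so a spectral cutoff
yields an enclosure on which `X` is bounded below. Every nonzero enclosure inside it then has a
projection of `v` of norm squared at least a fixed `c > 0`, which prevents endless splitting
(`exists_norm_starProjection_sq_ge`).

Zorn's lemma now fills `R` with orthogonal minimal enclosures. Since each `K p` maps into a single
site, a minimal enclosure contains the site components of its vectors, hence is `Enc` of any of its
nonzero vectors, in particular of one at a single site. Finally, members of the family are grouped
when linked by minimal enclosures orthogonal to neither: isolated members form `A`, the other groups
form `B`. -/

set_option linter.unusedSectionVars false

open scoped InnerProductSpace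
open ContinuousLinearMap (adjoint)
open Filter Topology

/-! ### Double sums of nonnegative terms -/

section Sums

variable {α β : Type*}

theorem hasSum_prod_of_nonneg {f : α × β → ℝ} (hf : ∀ p, 0 ≤ f p) {g : α → ℝ} {c : ℝ}
    (h : ∀ a, HasSum (fun b => f (a, b)) (g a)) (hg : HasSum g c) : HasSum f c := by
  have hs : Summable f := by
    rw [summable_prod_of_nonneg hf]
    exact ⟨fun a => (h a).summable, by simpa only [(h _).tsum_eq] using hg.summable⟩
  have h2 := hs.hasSum.prod_fiberwise h
  rw [hg.unique h2]
  exact hs.hasSum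

theorem hasSum_swap_of_nonneg {f : α → β → ℝ} (hf : ∀ a b, 0 ≤ f a b) {g : α → ℝ} {k : β → ℝ}
    {c : ℝ} (h : ∀ a, HasSum (f a) (g a)) (hg : HasSum g c)
    (h' : ∀ b, HasSum (fun a => f a b) (k b)) : HasSum k c := by
  have h1 : HasSum (fun p : α × β => f p.1 p.2) c :=
    hasSum_prod_of_nonneg (fun p => hf p.1 p.2) h hg
  have h2 : HasSum (fun p : β × α => f p.2 p.1) c := (Equiv.prodComm β α).hasSum_iff.mpr h1
  exact h2.prod_fiberwise h'

end Sums

/-! ### Positive trace-class operators as sums of rank-one operators -/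

section Represents

variable {E : Type*} [NormedAddCommGroup E] [InnerProductSpace ℂ E]

theorem inner_self_eq_ofReal (x : E) : ⟪x, x⟫_ℂ = ((‖x‖ ^ 2 : ℝ) : ℂ) := by
  rw [inner_self_eq_norm_sq_to_K]
  norm_cast

theorem inner_mul_inner_swap (x y : E) :
    ⟪x, y⟫_ℂ * ⟪y, x⟫_ℂ = ((‖⟪y, x⟫_ℂ‖ ^ 2 : ℝ) : ℂ) := by
  rw [← inner_conj_symm, ← Complex.normSq_eq_conj_mul_self, Complex.normSq_eq_norm_sq]

theorem HilbertBasis.hasSum_norm_inner_sq {κ : Type*} (b : HilbertBasis κ ℂ E) (x : E) :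
    HasSum (fun e => ‖⟪b e, x⟫_ℂ‖ ^ 2) (‖x‖ ^ 2) := by
  have h := b.hasSum_inner_mul_inner x x
  simp only [inner_mul_inner_swap, inner_self_eq_ofReal] at h
  exact Complex.hasSum_ofReal.1 h

/-- `ρ = ∑ b, |r b⟩⟨r b|` with `∑ b, ‖r b‖²` finite. -/
def Represents {β : Type*} (r : β → E) (ρ : E →L[ℂ] E) : Prop :=
  (Summable fun b => ‖r b‖ ^ 2) ∧
    ∀ x, HasSum (fun b => ((‖⟪r b, x⟫_ℂ‖ ^ 2 : ℝ) : ℂ)) ⟪x, ρ x⟫_ℂ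

namespace Represents

variable {β γ : Type*} {r : β → E} {s : γ → E} {ρ ρ' : E →L[ℂ] E}

theorem re_hasSum (h : Represents r ρ) (x : E) :
    HasSum (fun b => ‖⟪r b, x⟫_ℂ‖ ^ 2) (⟪x, ρ x⟫_ℂ).re := by
  simpa only [Complex.ofReal_re] using Complex.hasSum_re (h.2 x)

theorem inner_eq_re (h : Represents r ρ) (x : E) : ⟪x, ρ x⟫_ℂ = ((⟪x, ρ x⟫_ℂ).re : ℂ) :=
  (h.2 x).unique (Complex.hasSum_ofReal.2 (h.re_hasSum x))

theorem inner_nonneg (h : Represents r ρ) (x : E) : 0 ≤ (⟪x, ρ x⟫_ℂ).re :=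
  (h.re_hasSum x).nonneg fun _ => by positivity

theorem eq_of_inner_self {S T : E →L[ℂ] E} (h : ∀ x, ⟪x, S x⟫_ℂ = ⟪x, T x⟫_ℂ) : S = T := by
  have := (ext_inner_map S.toLinearMap T.toLinearMap).1 fun x => by
    rw [← inner_conj_symm, ← inner_conj_symm (T.toLinearMap x)]
    exact congrArg _ (h x)
  ext x
  exact LinearMap.congr_fun this x

theorem eq (h : Represents r ρ) (h' : Represents r ρ') : ρ = ρ' :=
  eq_of_inner_self fun x => (h.2 x).unique (h'.2 x)

/-- Parseval for each `r i`, then an exchange of sums. The trace thus depends neither on the basis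
nor on the chosen decomposition. -/
theorem hasSum_trace (h : Represents r ρ) {κ : Type*} (b : HilbertBasis κ ℂ E) :
    HasSum (fun e => (⟪b e, ρ (b e)⟫_ℂ).re) (∑' i, ‖r i‖ ^ 2) := by
  refine hasSum_swap_of_nonneg (f := fun i e => ‖⟪r i, b e⟫_ℂ‖ ^ 2) (fun _ _ => by positivity)
    (fun i => ?_) h.1.hasSum (fun e => h.re_hasSum (b e))
  simpa only [norm_inner_symm] using b.hasSum_norm_inner_sq (r i)

theorem hasSum_trace_complex (h : Represents r ρ) {κ : Type*} (b : HilbertBasis κ ℂ E) :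
    HasSum (fun e => ⟪b e, ρ (b e)⟫_ℂ) ((∑' i, ‖r i‖ ^ 2 : ℝ) : ℂ) := by
  have := h.hasSum_trace b
  rw [funext fun e => h.inner_eq_re (b e)]
  exact Complex.hasSum_ofReal.2 this

theorem isPositive (h : Represents r ρ) : ρ.IsPositive := by
  rw [ContinuousLinearMap.isPositive_iff_complex]
  intro x
  have h1 := h.inner_eq_re x
  have h2 := h.inner_nonneg x
  rw [← inner_conj_symm, h1]
  simp [h2]

theorem smul (h : Represents r ρ) (c : ℝ) :
    Represents (fun b => (c : ℂ) • r b) (((c ^ 2 : ℝ) : ℂ) • ρ) := by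
  refine ⟨?_, fun x => ?_⟩
  · simpa only [norm_smul, mul_pow] using h.1.mul_left _
  · have := (h.2 x).mul_left ((c ^ 2 : ℝ) : ℂ)
    simpa [inner_smul_left, inner_smul_right, mul_pow] using this

variable [CompleteSpace E]

theorem tsum_eq (h : Represents r ρ) (h' : Represents s ρ) :
    ∑' i, ‖r i‖ ^ 2 = ∑' i, ‖s i‖ ^ 2 := by
  obtain ⟨w, b, -⟩ := exists_hilbertBasis ℂ E
  exact (h.hasSum_trace b).unique (h'.hasSum_trace b)

theorem isTraceClass (h : Represents r ρ) : IsTraceClass ρ := by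
  intro w b
  rw [CFC.abs_of_nonneg ρ ((ContinuousLinearMap.nonneg_iff_isPositive ρ).2 h.isPositive)]
  exact (h.hasSum_trace_complex b).summable

theorem comp (h : Represents r ρ) (T : E →L[ℂ] E) :
    Represents (fun b => T (r b)) (T.comp (ρ.comp (ContinuousLinearMap.adjoint T))) := by
  refine ⟨.of_nonneg_of_le (fun _ => by positivity) (fun b => ?_) (h.1.mul_left (‖T‖ ^ 2)),
    fun x => ?_⟩
  · rw [← mul_pow]
    exact pow_le_pow_left₀ (norm_nonneg _) (T.le_opNorm _) 2
  · have := h.2 (ContinuousLinearMap.adjoint T x)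
    simp only [ContinuousLinearMap.adjoint_inner_right,
      ContinuousLinearMap.adjoint_inner_left] at this
    simpa using this

/-- Bounds the operator norm by the trace, which is what makes the series of `krausMap` converge in
operator norm. -/
theorem norm_le (h : Represents r ρ) : ‖ρ‖ ≤ ∑' i, ‖r i‖ ^ 2 := by
  have h0 : 0 ≤ ∑' i, ‖r i‖ ^ 2 := tsum_nonneg fun _ => by positivity
  rw [CStarAlgebra.norm_le_iff_le_algebraMap ρ h0
    ((ContinuousLinearMap.nonneg_iff_isPositive ρ).2 h.isPositive), ContinuousLinearMap.le_def,
    ContinuousLinearMap.isPositive_iff_complex]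
  intro x
  have h1 : (⟪x, ρ x⟫_ℂ).re ≤ (∑' i, ‖r i‖ ^ 2) * ‖x‖ ^ 2 := by
    refine hasSum_le (fun b => ?_) (h.re_hasSum x) (h.1.hasSum.mul_right (‖x‖ ^ 2))
    rw [← mul_pow]
    exact pow_le_pow_left₀ (norm_nonneg _) (norm_inner_le_norm _ _) 2
  have h2 : ⟪(algebraMap ℝ (E →L[ℂ] E) (∑' i, ‖r i‖ ^ 2) - ρ) x, x⟫_ℂ
      = (((∑' i, ‖r i‖ ^ 2) * ‖x‖ ^ 2 - (⟪x, ρ x⟫_ℂ).re : ℝ) : ℂ) := by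
    have h3 : algebraMap ℝ (E →L[ℂ] E) (∑' i, ‖r i‖ ^ 2) x = ((∑' i, ‖r i‖ ^ 2 : ℝ) : ℂ) • x := by
      rw [Algebra.algebraMap_eq_smul_one, Complex.coe_smul]
      rfl
    rw [sub_apply, inner_sub_left, ← inner_conj_symm (ρ x), h.inner_eq_re,
      Complex.conj_ofReal, h3, inner_smul_left, Complex.conj_ofReal, inner_self_eq_ofReal,
      Complex.ofReal_sub, Complex.ofReal_mul, Complex.ofReal_re]
  rw [h2]
  refine ⟨?_, ?_⟩
  · exact congrArg Complex.ofReal (Complex.ofReal_re _)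
  · exact (sub_nonneg.2 h1).trans_eq (Complex.ofReal_re _).symm

theorem opSupport_eq (h : Represents r ρ) :
    opSupport ρ = (Submodule.span ℂ (Set.range r)).topologicalClosure := by
  rw [← Submodule.orthogonal_orthogonal_eq_closure, opSupport]
  congr 1
  ext x
  have hmem : x ∈ (Submodule.span ℂ (Set.range r))ᗮ ↔ ∀ b, ⟪r b, x⟫_ℂ = 0 := by
    rw [← Submodule.span_singleton_le_iff_mem, ← Submodule.isOrtho_iff_le,
      Submodule.isOrtho_comm, Submodule.isOrtho_span]
    simp
  rw [hmem]
  constructor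
  · intro hx b
    have h1 := h.re_hasSum x
    rw [show ρ x = 0 from hx, inner_zero_right] at h1
    have := (hasSum_zero_iff_of_nonneg (fun _ => by positivity)).1 h1
    simpa using congrFun this b
  · intro hx
    have h0 : ⟪x, ρ x⟫_ℂ = 0 := (h.2 x).unique (by simp [hx, hasSum_zero])
    -- Writing `ρ = S† S`, the vanishing of `⟨x, ρ x⟩ = ‖S x‖²` gives `ρ x = 0`.
    obtain ⟨S, hS⟩ := (CStarAlgebra.nonneg_iff_eq_star_mul_self (a := ρ)).1
      ((ContinuousLinearMap.nonneg_iff_isPositive ρ).2 h.isPositive)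
    have h1 : S x = 0 := by
      rw [hS] at h0
      rw [← inner_self_eq_zero (𝕜 := ℂ), ← ContinuousLinearMap.adjoint_inner_right]
      exact h0
    change ρ x = 0
    rw [hS]
    change star S (S x) = 0
    rw [h1, map_zero]

theorem mem_opSupport (h : Represents r ρ) (b : β) : r b ∈ opSupport ρ := by
  rw [h.opSupport_eq]
  exact Submodule.le_topologicalClosure _ (Submodule.subset_span ⟨b, rfl⟩)

theorem opSupport_le (h : Represents r ρ) {W : Submodule ℂ E} (hW : IsClosed (W : Set E))
    (hr : ∀ b, r b ∈ W) : opSupport ρ ≤ W := by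
  rw [h.opSupport_eq]
  refine Submodule.topologicalClosure_minimal _ (Submodule.span_le.2 ?_) hW
  rintro _ ⟨b, rfl⟩
  exact hr b

end Represents

variable [CompleteSpace E]

theorem represents_sqrt {ρ : E →L[ℂ] E} (hρ : ρ.IsPositive) {w : Set E} (b : HilbertBasis w ℂ E)
    (ht : IsTraceClass ρ) : Represents (fun e : w => CFC.sqrt ρ (b e)) ρ := by
  have h0 : 0 ≤ ρ := (ContinuousLinearMap.nonneg_iff_isPositive ρ).2 hρ
  have hs : ContinuousLinearMap.adjoint (CFC.sqrt ρ) = CFC.sqrt ρ :=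
    (IsSelfAdjoint.of_nonneg (CFC.sqrt_nonneg ρ))
  have hm : ∀ x, CFC.sqrt ρ (CFC.sqrt ρ x) = ρ x := fun x =>
    congrArg (fun T : E →L[ℂ] E => T x) (CFC.sqrt_mul_sqrt_self ρ h0)
  have hi : ∀ x y, ⟪CFC.sqrt ρ x, CFC.sqrt ρ y⟫_ℂ = ⟪x, ρ y⟫_ℂ := fun x y => by
    rw [← hm y, ← ContinuousLinearMap.adjoint_inner_right (CFC.sqrt ρ), hs]
  refine ⟨?_, fun x => ?_⟩
  · have h1 := ht w b
    rw [CFC.abs_of_nonneg ρ h0] at h1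
    have h2 : ∀ e, ⟪b e, ρ (b e)⟫_ℂ = ((‖CFC.sqrt ρ (b e)‖ ^ 2 : ℝ) : ℂ) := fun e => by
      rw [← hi, inner_self_eq_ofReal]
    simp only [h2] at h1
    exact_mod_cast h1
  · rw [← hi, inner_self_eq_ofReal]
    have := b.hasSum_norm_inner_sq (CFC.sqrt ρ x)
    have h2 : ∀ e, ⟪b e, CFC.sqrt ρ x⟫_ℂ = ⟪CFC.sqrt ρ (b e), x⟫_ℂ := fun e => by
      rw [← ContinuousLinearMap.adjoint_inner_left, hs]
    simp only [h2] at this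
    exact Complex.hasSum_ofReal.2 this

theorem exists_represents {ρ : E →L[ℂ] E} (hρ : ρ.IsPositive) (ht : IsTraceClass ρ) :
    ∃ (w : Set E) (r : w → E), Represents r ρ := by
  obtain ⟨w, b, -⟩ := exists_hilbertBasis ℂ E
  exact ⟨w, _, represents_sqrt hρ b ht⟩

theorem represents_single (x : E) :
    Represents (fun _ : Unit => x) (InnerProductSpace.rankOne ℂ x x) := by
  refine ⟨Summable.of_finite, fun y => ?_⟩
  have : ⟪y, InnerProductSpace.rankOne ℂ x x y⟫_ℂ = ((‖⟪x, y⟫_ℂ‖ ^ 2 : ℝ) : ℂ) := by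
    rw [InnerProductSpace.rankOne_apply, inner_smul_right, inner_mul_inner_swap,
      norm_inner_symm]
  rw [this]
  exact hasSum_unique _

theorem Represents.isState {β : Type*} {r : β → E} {ρ : E →L[ℂ] E} (h : Represents r ρ)
    (h1 : ∑' b, ‖r b‖ ^ 2 = 1) : IsState ρ :=
  ⟨h.isPositive, h.isTraceClass, fun w b => by simpa [h1] using h.hasSum_trace_complex b⟩

end Represents

/-! ### Kraus families, invariant subspaces and the recurrent space -/

section Kraus

variable {E : Type*} [NormedAddCommGroup E] [InnerProductSpace ℂ E] {ι : Type*}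

/-- `∑ p, (K p)† (K p) = 1`, stated through the quadratic forms. -/
def IsKrausFamily (K : ι → E →L[ℂ] E) : Prop :=
  ∀ x, HasSum (fun p => ‖K p x‖ ^ 2) (‖x‖ ^ 2)

/-- A closed subspace invariant under all operators of the family. -/
def IsInvariantSubspace (K : ι → E →L[ℂ] E) (W : Submodule ℂ E) : Prop :=
  IsClosed (W : Set E) ∧ ∀ p, ∀ x ∈ W, K p x ∈ W

variable {K : ι → E →L[ℂ] E}

theorem ContinuousLinearMap.map_mem_of_mem_closure (T : E →L[ℂ] E) {U W : Submodule ℂ E}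
    (hW : IsClosed (W : Set E)) (h : ∀ x ∈ U, T x ∈ W) {x : E} (hx : x ∈ U.topologicalClosure) :
    T x ∈ W := by
  have : U.topologicalClosure ≤ W.comap T.toLinearMap :=
    Submodule.topologicalClosure_minimal _ h (hW.preimage T.continuous)
  exact this hx

theorem ContinuousLinearMap.map_mem_of_mem_closure_span (T : E →L[ℂ] E) {S : Set E}
    {W : Submodule ℂ E} (hW : IsClosed (W : Set E)) (h : ∀ x ∈ S, T x ∈ W) {x : E}
    (hx : x ∈ (Submodule.span ℂ S).topologicalClosure) : T x ∈ W :=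
  T.map_mem_of_mem_closure hW
    (show Submodule.span ℂ S ≤ W.comap T.toLinearMap from Submodule.span_le.2 h) hx

namespace IsKrausFamily

/-- `x ↦ (X (K p x))ₚ`, as an operator into the `ℓ²` sum of copies of `E`. -/
noncomputable def dilation (hK : IsKrausFamily K) (X : E →L[ℂ] E) : E →L[ℂ] lp (fun _ : ι => E) 2 :=
  have hb : ∀ x p, ‖X (K p x)‖ ^ 2 ≤ ‖X‖ ^ 2 * ‖K p x‖ ^ 2 := fun x p => by
    rw [← mul_pow]
    exact pow_le_pow_left₀ (norm_nonneg _) (X.le_opNorm _) 2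
  LinearMap.mkContinuous
    { toFun := fun x => ⟨fun p => X (K p x), by
        refine memℓp_gen ?_
        simp only [ENNReal.toReal_ofNat, Real.rpow_two]
        exact .of_nonneg_of_le (fun _ => by positivity) (hb x) ((hK x).summable.mul_left _)⟩
      map_add' := fun x y => by ext p; exact (congrArg X (map_add (K p) x y)).trans (map_add X _ _)
      map_smul' := fun c x => by ext p; simp }
    ‖X‖ fun x => by
      refine (sq_le_sq₀ (norm_nonneg _) (by positivity)).1 ?_
      have h := lp.norm_rpow_eq_tsum (p := 2) (by simp) (E := fun _ : ι => E)
      simp only [ENNReal.toReal_ofNat, Real.rpow_two] at h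
      rw [h, mul_pow]
      refine (Summable.tsum_le_tsum (hb x) ?_ ((hK x).summable.mul_left _)).trans_eq ?_
      · exact .of_nonneg_of_le (fun _ => by positivity) (hb x) ((hK x).summable.mul_left _)
      · rw [tsum_mul_left, (hK x).tsum_eq]

theorem norm_dilation_le (hK : IsKrausFamily K) (X : E →L[ℂ] E) : ‖hK.dilation X‖ ≤ ‖X‖ := by
  unfold dilation
  exact LinearMap.mkContinuous_norm_le _ (norm_nonneg _) _

variable [CompleteSpace E]

/-- The dual map `X ↦ ∑ p, (K p)† X (K p)`. -/
noncomputable def dualMap (hK : IsKrausFamily K) (X : E →L[ℂ] E) : E →L[ℂ] E :=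
  (adjoint (hK.dilation 1)).comp (hK.dilation X)

/-- An inner product in the `ℓ²` dilation space, so the operator series `∑ (K p)† X (K p)` never has
to be summed. -/
theorem hasSum_dualMap (hK : IsKrausFamily K) (X : E →L[ℂ] E) (x y : E) :
    HasSum (fun p => ⟪K p x, X (K p y)⟫_ℂ) ⟪x, hK.dualMap X y⟫_ℂ := by
  rw [dualMap, ContinuousLinearMap.comp_apply, ContinuousLinearMap.adjoint_inner_right]
  exact lp.hasSum_inner (hK.dilation 1 x) (hK.dilation X y)

theorem norm_dualMap_le (hK : IsKrausFamily K) (X : E →L[ℂ] E) : ‖hK.dualMap X‖ ≤ ‖X‖ := by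
  refine (ContinuousLinearMap.opNorm_comp_le _ _).trans ?_
  have h1 : ‖adjoint (hK.dilation 1)‖ ≤ 1 := by
    rw [LinearIsometryEquiv.norm_map]
    exact (hK.norm_dilation_le 1).trans ContinuousLinearMap.norm_id_le
  calc _ ≤ 1 * ‖X‖ := by gcongr; exact hK.norm_dilation_le X
    _ = ‖X‖ := one_mul _

theorem dualMap_one (hK : IsKrausFamily K) : hK.dualMap 1 = 1 := by
  refine Represents.eq_of_inner_self fun x => (hK.hasSum_dualMap 1 x x).unique ?_
  simp only [one_apply_eq_self, inner_self_eq_ofReal]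
  exact Complex.hasSum_ofReal.2 (hK x)

theorem hasSum_inner (hK : IsKrausFamily K) (x y : E) :
    HasSum (fun p => ⟪K p x, K p y⟫_ℂ) ⟪x, y⟫_ℂ := by
  simpa [hK.dualMap_one] using hK.hasSum_dualMap 1 x y

theorem dualMap_add (hK : IsKrausFamily K) (X Y : E →L[ℂ] E) :
    hK.dualMap (X + Y) = hK.dualMap X + hK.dualMap Y := by
  refine Represents.eq_of_inner_self fun x => (hK.hasSum_dualMap _ x x).unique ?_
  simpa [inner_add_right] using (hK.hasSum_dualMap X x x).add (hK.hasSum_dualMap Y x x)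

theorem dualMap_smul (hK : IsKrausFamily K) (c : ℂ) (X : E →L[ℂ] E) :
    hK.dualMap (c • X) = c • hK.dualMap X := by
  refine Represents.eq_of_inner_self fun x => (hK.hasSum_dualMap _ x x).unique ?_
  simpa [inner_smul_right] using (hK.hasSum_dualMap X x x).mul_left c

theorem dualMap_nonneg (hK : IsKrausFamily K) {X : E →L[ℂ] E} (hX : 0 ≤ X) :
    0 ≤ hK.dualMap X := by
  rw [ContinuousLinearMap.nonneg_iff_isPositive] at hX ⊢
  rw [ContinuousLinearMap.isPositive_iff_complex] at hX ⊢
  intro x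
  have h : HasSum (fun p => ⟪X (K p x), K p x⟫_ℂ) ⟪hK.dualMap X x, x⟫_ℂ := by
    have := (hK.hasSum_dualMap X x x).star
    simpa only [← starRingEnd_apply, inner_conj_symm] using this
  have h1 := Complex.hasSum_re h
  refine ⟨HasSum.unique ?_ h, h1.nonneg fun p => (hX _).2⟩
  rw [← funext fun p => (hX (K p x)).1]
  exact Complex.hasSum_ofReal.2 h1

end IsKrausFamily

variable [CompleteSpace E]

/-- The map `ρ ↦ ∑ p, (K p) ρ (K p)†`. -/
noncomputable def krausMap (K : ι → E →L[ℂ] E) (ρ : E →L[ℂ] E) : E →L[ℂ] E :=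
  ∑' p, (K p).comp (ρ.comp (adjoint (K p)))

variable {β : Type*} {r : β → E} {ρ : E →L[ℂ] E}

/-- The normalization of the `K p` makes the squared norms of the `K p (r b)` sum to those of the `r
b`; this gives the convergence of the series and carries trace preservation. -/
theorem Represents.krausMap (hK : IsKrausFamily K) (h : Represents r ρ) :
    Represents (fun q : ι × β => K q.1 (r q.2)) (krausMap K ρ) := by
  have h1 : Summable fun q : ι × β => ‖K q.1 (r q.2)‖ ^ 2 := by
    have : HasSum (fun q : β × ι => ‖K q.2 (r q.1)‖ ^ 2) _ :=
      hasSum_prod_of_nonneg (fun _ => by positivity) (fun b => hK (r b)) h.1.hasSum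
    exact ((Equiv.prodComm ι β).hasSum_iff.mpr this).summable
  have h2 : Summable fun p => (K p).comp (ρ.comp (adjoint (K p))) :=
    Summable.of_norm_bounded h1.prod fun p => (h.comp (K p)).norm_le
  refine ⟨h1, fun x => ?_⟩
  have h3 : HasSum (fun p => ⟪x, (K p).comp (ρ.comp (adjoint (K p))) x⟫_ℂ)
      ⟪x, _root_.krausMap K ρ x⟫_ℂ :=
    (h2.hasSum.mapL (ContinuousLinearMap.apply ℂ E x)).mapL (innerSL ℂ x)
  have h4 := Complex.hasSum_re h3
  have h5 := hasSum_prod_of_nonneg (f := fun q : ι × β => ‖⟪K q.1 (r q.2), x⟫_ℂ‖ ^ 2)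
    (fun _ => by positivity) (fun p => (h.comp (K p)).re_hasSum x) h4
  have h6 : ⟪x, _root_.krausMap K ρ x⟫_ℂ = ((⟪x, _root_.krausMap K ρ x⟫_ℂ).re : ℂ) := by
    refine h3.unique ?_
    rw [funext fun p => (h.comp (K p)).inner_eq_re x]
    exact Complex.hasSum_ofReal.2 h4
  rw [h6]
  exact Complex.hasSum_ofReal.2 h5

/-- One direction tests on `|x⟩⟨x|` with `x ∈ W`; the other uses that the vectors of a decomposition
lie in the support and span it densely. -/
theorem isInvariantSubspace_iff (hK : IsKrausFamily K) {W : Submodule ℂ E} :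
    (IsClosed (W : Set E) ∧ ∀ ρ : E →L[ℂ] E, ρ.IsPositive → IsTraceClass ρ →
      opSupport ρ ≤ W → opSupport (krausMap K ρ) ≤ W) ↔ IsInvariantSubspace K W := by
  refine and_congr_right fun hW => ⟨fun h p x hx => ?_, fun h ρ hρ ht hs => ?_⟩
  · have hr := represents_single x
    exact h _ hr.isPositive hr.isTraceClass (hr.opSupport_le hW fun _ => hx)
      ((hr.krausMap hK).mem_opSupport (p, ()))
  · obtain ⟨w, r, hr⟩ := exists_represents hρ ht
    exact (hr.krausMap hK).opSupport_le hW fun q => h _ _ (hs (hr.mem_opSupport _))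

/-- Since `X ρ X† = X M(ρ) X†`, the sums of `‖X (K p (r b))‖²` over `b, p` and of `‖X (r b)‖²` over
`b` agree. Expanding the square, `∑ ‖X K_p r_b - K_p X r_b‖²` over `p` is `∑ ‖X K_p r_b‖² - 2‖X
r_b‖² + ‖X r_b‖²`, where `hX` supplies the cross term. Summed over `b` this is zero, so every defect
vanishes. -/
theorem Represents.commute_of_hasSum (hK : IsKrausFamily K) (h : Represents r ρ)
    (hρ : _root_.krausMap K ρ = ρ) (X : E →L[ℂ] E)
    (hX : ∀ b, HasSum (fun p => (⟪X (K p (r b)), K p (X (r b))⟫_ℂ).re) (‖X (r b)‖ ^ 2))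
    (p : ι) {x : E} (hx : x ∈ opSupport ρ) : X (K p x) = K p (X x) := by
  have h1 := (h.krausMap hK).comp X
  have h2 := h.comp X
  rw [hρ] at h1
  have h3 : HasSum (fun q : β × ι => ‖X (K q.2 (r q.1))‖ ^ 2) (∑' b, ‖X (r b)‖ ^ 2) := by
    rw [← h1.tsum_eq h2]
    exact (Equiv.prodComm β ι).hasSum_iff.mpr h1.1.hasSum
  have h4 : ∀ b, HasSum (fun p => ‖X (K p (r b))‖ ^ 2) (∑' p, ‖X (K p (r b))‖ ^ 2) :=
    fun b => (h3.summable.prod_factor b).hasSum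
  have h5 := (h3.prod_fiberwise h4).sub h2.1.hasSum
  rw [sub_self] at h5
  have h6 : ∀ b, HasSum (fun p => ‖X (K p (r b)) - K p (X (r b))‖ ^ 2)
      (∑' p, ‖X (K p (r b))‖ ^ 2 - ‖X (r b)‖ ^ 2) := fun b => by
    have := ((h4 b).sub ((hX b).mul_left 2)).add (hK (X (r b)))
    have h7 : ∀ p, ‖X (K p (r b)) - K p (X (r b))‖ ^ 2 = ‖X (K p (r b))‖ ^ 2
        - 2 * (⟪X (K p (r b)), K p (X (r b))⟫_ℂ).re + ‖K p (X (r b))‖ ^ 2 := fun p =>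
      norm_sub_sq (𝕜 := ℂ) _ _
    simp only [h7]
    rwa [show ∑' p, ‖X (K p (r b))‖ ^ 2 - 2 * ‖X (r b)‖ ^ 2 + ‖X (r b)‖ ^ 2
      = ∑' p, ‖X (K p (r b))‖ ^ 2 - ‖X (r b)‖ ^ 2 by ring] at this
  have h7 := (hasSum_zero_iff_of_nonneg fun b => (h6 b).nonneg fun _ => by positivity).1 h5
  have h8 : ∀ b, X (K p (r b)) - K p (X (r b)) = 0 := fun b => by
    have h9 := h6 b
    rw [show _ = (0 : ℝ) from congrFun h7 b] at h9
    have := congrFun ((hasSum_zero_iff_of_nonneg fun _ => by positivity).1 h9) p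
    simpa using this
  rw [h.opSupport_eq] at hx
  have := ((X.comp (K p)) - (K p).comp X).map_mem_of_mem_closure_span (W := ⊥) (by simp)
    (by rintro _ ⟨b, rfl⟩; exact h8 b) hx
  exact sub_eq_zero.1 this

theorem Represents.isInvariantSubspace (hK : IsKrausFamily K) (h : Represents r ρ)
    (hρ : _root_.krausMap K ρ = ρ) : IsInvariantSubspace K (opSupport ρ) := by
  refine ⟨Submodule.isClosed_orthogonal _, fun p x hx => ?_⟩
  rw [h.opSupport_eq] at hx
  refine (K p).map_mem_of_mem_closure_span (Submodule.isClosed_orthogonal _) ?_ hx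
  rintro _ ⟨b, rfl⟩
  have := (h.krausMap hK).mem_opSupport (p, b)
  rwa [hρ] at this

namespace IsInvariantSubspace

variable {W W' : Submodule ℂ E}

theorem completeSpace (hW : IsInvariantSubspace K W) : CompleteSpace W :=
  hW.1.completeSpace_coe

theorem inf (hW : IsInvariantSubspace K W) (hW' : IsInvariantSubspace K W') :
    IsInvariantSubspace K (W ⊓ W') :=
  ⟨hW.1.inter hW'.1, fun p x hx => ⟨hW.2 p x hx.1, hW'.2 p x hx.2⟩⟩

theorem iSup_closure {κ : Sort*} {F : κ → Submodule ℂ E} (h : ∀ k, IsInvariantSubspace K (F k)) :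
    IsInvariantSubspace K (⨆ k, F k).topologicalClosure := by
  refine ⟨Submodule.isClosed_topologicalClosure _, fun p x hx => ?_⟩
  refine (K p).map_mem_of_mem_closure (Submodule.isClosed_topologicalClosure _) ?_ hx
  refine show (⨆ k, F k) ≤ (⨆ k, F k).topologicalClosure.comap (K p).toLinearMap from
    iSup_le fun k x hx => ?_
  exact Submodule.le_topologicalClosure _ (Submodule.mem_iSup_of_mem k ((h k).2 p x hx))

/-- Invariance puts `K p (P r)` in `W`, so the cross term is `⟨K_p r, K_p P r⟩`, which sums over `p`
to `⟨r, P r⟩ = ‖P r‖²`. -/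
theorem starProjection_comm (hK : IsKrausFamily K) (hW : IsInvariantSubspace K W)
    [W.HasOrthogonalProjection] (h : Represents r ρ) (hρ : krausMap K ρ = ρ) (p : ι) {x : E}
    (hx : x ∈ opSupport ρ) : W.starProjection (K p x) = K p (W.starProjection x) := by
  refine h.commute_of_hasSum hK hρ _ (fun b => ?_) p hx
  have h1 := Complex.hasSum_re (hK.hasSum_inner (r b) (W.starProjection (r b)))
  have h2 : ∀ p, ⟪W.starProjection (K p (r b)), K p (W.starProjection (r b))⟫_ℂ
      = ⟪K p (r b), K p (W.starProjection (r b))⟫_ℂ := fun p => by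
    rw [Submodule.inner_starProjection_left_eq_right,
      Submodule.starProjection_eq_self_iff.2 (hW.2 p _ (Submodule.starProjection_apply_mem _ _))]
  simp only [h2]
  have h3 : (⟪r b, W.starProjection (r b)⟫_ℂ).re = ‖W.starProjection (r b)‖ ^ 2 := by
    rw [← Submodule.starProjection_eq_self_iff.2 (Submodule.starProjection_apply_mem W (r b)),
      ← Submodule.inner_starProjection_left_eq_right,
      Submodule.starProjection_eq_self_iff.2 (Submodule.starProjection_apply_mem W (r b)),
      inner_self_eq_ofReal, Complex.ofReal_re]
  rwa [h3] at h1

theorem krausMap_compression (hK : IsKrausFamily K) (hW : IsInvariantSubspace K W)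
    [W.HasOrthogonalProjection] (h : Represents r ρ) (hρ : krausMap K ρ = ρ) :
    krausMap K (W.starProjection.comp (ρ.comp (adjoint W.starProjection)))
      = W.starProjection.comp (ρ.comp (adjoint W.starProjection)) := by
  have h1 := (h.comp W.starProjection).krausMap hK
  have h2 := (h.krausMap hK).comp W.starProjection
  simp only [hW.starProjection_comm hK h hρ _ (h.mem_opSupport _)] at h2
  rw [hρ] at h2
  exact h1.eq h2

end IsInvariantSubspace

/-- The closed linear span of the supports of all invariant states. -/
noncomputable def recurrentSpace (K : ι → E →L[ℂ] E) : Submodule ℂ E :=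
  (⨆ (ρ : E →L[ℂ] E) (_ : IsState ρ ∧ krausMap K ρ = ρ), opSupport ρ).topologicalClosure

theorem opSupport_le_recurrentSpace (hρ : IsState ρ ∧ krausMap K ρ = ρ) :
    opSupport ρ ≤ recurrentSpace K :=
  (le_iSup₂ (f := fun (ρ : E →L[ℂ] E) (_ : IsState ρ ∧ krausMap K ρ = ρ) => opSupport ρ) ρ hρ).trans
    (Submodule.le_topologicalClosure _)

theorem isInvariantSubspace_recurrentSpace (hK : IsKrausFamily K) :
    IsInvariantSubspace K (recurrentSpace K) := by
  unfold recurrentSpace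
  rw [iSup_subtype']
  refine IsInvariantSubspace.iSup_closure fun ρ => ?_
  obtain ⟨w, r, hr⟩ := exists_represents ρ.2.1.1 ρ.2.1.2.1
  exact hr.isInvariantSubspace hK ρ.2.2

theorem recurrentSpace_le {W : Submodule ℂ E} (hW : IsClosed (W : Set E))
    (h : ∀ ρ : E →L[ℂ] E, IsState ρ → krausMap K ρ = ρ → opSupport ρ ≤ W) :
    recurrentSpace K ≤ W :=
  Submodule.topologicalClosure_minimal _ (iSup₂_le fun ρ hρ => h ρ hρ.1 hρ.2) hW

namespace IsInvariantSubspace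

variable {W W' : Submodule ℂ E}

theorem starProjection_comm_of_mem (hK : IsKrausFamily K) (hW : IsInvariantSubspace K W)
    [W.HasOrthogonalProjection] (p : ι) {x : E} (hx : x ∈ recurrentSpace K) :
    W.starProjection (K p x) = K p (W.starProjection x) := by
  let T : E →L[ℂ] E := W.starProjection.comp (K p) - (K p).comp W.starProjection
  have h : recurrentSpace K ≤ LinearMap.ker T.toLinearMap := by
    refine recurrentSpace_le T.isClosed_ker fun ρ hρ hi x hx => ?_
    obtain ⟨w, r, hr⟩ := exists_represents hρ.1 hρ.2.1
    exact sub_eq_zero.2 (hW.starProjection_comm hK hr hi p hx)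
  exact sub_eq_zero.1 (h hx)

theorem recurrentSpace_inf_orthogonal (hK : IsKrausFamily K) (hW : IsInvariantSubspace K W) :
    IsInvariantSubspace K (recurrentSpace K ⊓ Wᗮ) := by
  have := hW.completeSpace
  refine ⟨(isInvariantSubspace_recurrentSpace hK).1.inter (Submodule.isClosed_orthogonal _),
    fun p x hx => ⟨(isInvariantSubspace_recurrentSpace hK).2 p x hx.1, ?_⟩⟩
  refine (Submodule.starProjection_apply_eq_zero_iff W).1 ?_
  rw [hW.starProjection_comm_of_mem hK p hx.1,
    (Submodule.starProjection_apply_eq_zero_iff W).2 hx.2, map_zero]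

/-- If `W` is not orthogonal to `R`, some invariant state has a nonzero compression to `W`. The
compression is invariant, and dividing by its trace `t` makes it a state. -/
theorem exists_state (hK : IsKrausFamily K) (hW : IsInvariantSubspace K W)
    (h : ¬ W ⟂ recurrentSpace K) :
    ∃ ρ : E →L[ℂ] E, (IsState ρ ∧ krausMap K ρ = ρ) ∧ opSupport ρ ≤ W := by
  have := hW.completeSpace
  by_contra! hne
  refine h (Submodule.isOrtho_comm.1 (recurrentSpace_le (Submodule.isClosed_orthogonal _)
    fun ρ hρ hi => ?_))
  obtain ⟨w, r, hr⟩ := exists_represents hρ.1 hρ.2.1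
  refine hr.opSupport_le (Submodule.isClosed_orthogonal _) fun b => ?_
  rw [← Submodule.starProjection_apply_eq_zero_iff]
  by_contra hb
  have h1 := hr.comp W.starProjection
  set t := ∑' b, ‖W.starProjection (r b)‖ ^ 2 with ht
  have ht0 : 0 < t := h1.1.tsum_pos (fun _ => by positivity) b (by positivity)
  have h2 := h1.smul (Real.sqrt t)⁻¹
  refine hne _ ⟨h2.isState ?_, ?_⟩ (h2.opSupport_le hW.1 fun b =>
    W.smul_mem _ (Submodule.starProjection_apply_mem _ _))
  · simp only [norm_smul, mul_pow, tsum_mul_left, ← ht]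
    simp only [Complex.norm_real, Real.norm_eq_abs, sq_abs, inv_pow, Real.sq_sqrt ht0.le]
    exact inv_mul_cancel₀ ht0.ne'
  · have h3 := h2.krausMap hK
    have h4 := (h1.krausMap hK).smul (Real.sqrt t)⁻¹
    rw [hW.krausMap_compression hK hr hi] at h4
    simp only [map_smul] at h3
    exact h3.eq h4

theorem inf_recurrentSpace_ne_bot (hK : IsKrausFamily K) (hW : IsInvariantSubspace K W)
    (h : ¬ W ⟂ recurrentSpace K) : W ⊓ recurrentSpace K ≠ ⊥ := by
  obtain ⟨ρ, hρ, hs⟩ := hW.exists_state hK h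
  intro hbot
  have h0 : opSupport ρ ≤ ⊥ := hbot ▸ le_inf hs (opSupport_le_recurrentSpace hρ)
  obtain ⟨w, b, -⟩ := exists_hilbertBasis ℂ E
  have h1 := represents_sqrt hρ.1.1 b hρ.1.2.1
  have h2 := h1.hasSum_trace_complex b
  have h3 : ∀ e : w, CFC.sqrt ρ (b e) = 0 := fun e => by simpa using h0 (h1.mem_opSupport e)
  simp only [h3] at h2
  simpa using h2.unique (hρ.1.2.2 w b)

end IsInvariantSubspace

end Kraus

/-! ### Fixed points of the dual map by Cesàro averaging -/

section Cesaro

variable {E : Type*} [NormedAddCommGroup E] [InnerProductSpace ℂ E] [CompleteSpace E]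

/-- Weak operator compactness of balls: the pointwise ultrafilter limits of the sesquilinear forms
again form a bounded sesquilinear form. -/
theorem exists_tendsto_inner_of_bounded {α : Type*} (U : Ultrafilter α) {T : α → E →L[ℂ] E} {C : ℝ}
    (hT : ∀ n, ‖T n‖ ≤ C) :
    ∃ X : E →L[ℂ] E, ∀ x y, Tendsto (fun n => ⟪x, T n y⟫_ℂ) U (𝓝 ⟪x, X y⟫_ℂ) := by
  have hb : ∀ x y n, ‖⟪x, T n y⟫_ℂ‖ ≤ C * ‖x‖ * ‖y‖ := fun x y n => by
    refine (norm_inner_le_norm x _).trans ?_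
    calc ‖x‖ * ‖T n y‖ ≤ ‖x‖ * (C * ‖y‖) := by
          gcongr
          exact (T n).le_of_opNorm_le (hT n) y
      _ = _ := by ring
  have hl : ∀ x y, ∃ z, Tendsto (fun n => ⟪x, T n y⟫_ℂ) U (𝓝 z) := fun x y => by
    obtain ⟨z, -, hz⟩ := (isCompact_closedBall (0 : ℂ) (C * ‖x‖ * ‖y‖)).ultrafilter_le_nhds
      (U.map fun n => ⟪x, T n y⟫_ℂ) (by
        rw [le_principal_iff, Ultrafilter.mem_coe, Ultrafilter.mem_map]
        exact Filter.univ_mem' fun n => mem_closedBall_zero_iff.2 (hb x y n))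
    exact ⟨z, hz⟩
  choose B hB using hl
  let L : E →ₗ⋆[ℂ] E →ₗ[ℂ] ℂ := LinearMap.mk₂'ₛₗ (starRingEnd ℂ) (RingHom.id ℂ) B
    (fun x x' y => tendsto_nhds_unique (hB _ _) (by
      simpa only [inner_add_left] using (hB x y).add (hB x' y)))
    (fun c x y => tendsto_nhds_unique (hB _ _) (by
      simpa only [inner_smul_left, smul_eq_mul] using (hB x y).const_mul (starRingEnd ℂ c)))
    (fun x y y' => tendsto_nhds_unique (hB _ _) (by
      simpa only [map_add, inner_add_right] using (hB x y).add (hB x y')))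
    (fun c x y => tendsto_nhds_unique (hB _ _) (by
      simpa only [map_smul, inner_smul_right, smul_eq_mul, RingHom.id_apply]
        using (hB x y).const_mul c))
  let L' : E →L⋆[ℂ] E →L[ℂ] ℂ := L.mkContinuous₂ C fun x y =>
    le_of_tendsto (hB x y).norm (Eventually.of_forall (hb x y))
  refine ⟨adjoint (InnerProductSpace.continuousLinearMapOfBilin L'), fun x y => ?_⟩
  rw [ContinuousLinearMap.adjoint_inner_right,
    InnerProductSpace.continuousLinearMapOfBilin_apply]
  exact hB x y

theorem isPositive_of_tendsto_inner {α : Type*} {U : Filter α} [U.NeBot] {T : α → E →L[ℂ] E}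
    (hT : ∀ n, 0 ≤ T n) {X : E →L[ℂ] E}
    (hX : ∀ x y, Tendsto (fun n => ⟪x, T n y⟫_ℂ) U (𝓝 ⟪x, X y⟫_ℂ)) : 0 ≤ X := by
  rw [ContinuousLinearMap.nonneg_iff_isPositive, ContinuousLinearMap.isPositive_iff_complex]
  have hT' : ∀ n, (T n).IsPositive := fun n => (ContinuousLinearMap.nonneg_iff_isPositive _).1 (hT n)
  intro x
  have h : Tendsto (fun n => ⟪T n x, x⟫_ℂ) U (𝓝 ⟪X x, x⟫_ℂ) := by
    have := (hX x x).star
    simpa only [← starRingEnd_apply, inner_conj_symm] using this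
  have h1 := (Complex.continuous_re.tendsto _).comp h
  refine ⟨tendsto_nhds_unique ?_ h, ge_of_tendsto h1 (Eventually.of_forall fun n =>
    ((ContinuousLinearMap.isPositive_iff_complex _).1 (hT' n) x).2)⟩
  have h2 := (Complex.continuous_ofReal.tendsto _).comp h1
  refine h2.congr fun n => ?_
  exact ((ContinuousLinearMap.isPositive_iff_complex _).1 (hT' n) x).1

variable {ι : Type*} {K : ι → E →L[ℂ] E} {β : Type*} {r : β → E} {ρ : E →L[ℂ] E}

theorem norm_sqrt_apply_sq {T : E →L[ℂ] E} (hT : 0 ≤ T) (x : E) :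
    ‖CFC.sqrt T x‖ ^ 2 = (⟪x, T x⟫_ℂ).re := by
  have hs : adjoint (CFC.sqrt T) = CFC.sqrt T := IsSelfAdjoint.of_nonneg (CFC.sqrt_nonneg T)
  have hm : CFC.sqrt T (CFC.sqrt T x) = T x :=
    congrArg (fun S : E →L[ℂ] E => S x) (CFC.sqrt_mul_sqrt_self T hT)
  rw [← hm, ← ContinuousLinearMap.adjoint_inner_left, hs, inner_self_eq_ofReal, Complex.ofReal_re]

theorem Represents.summable_re_inner (h : Represents r ρ) {T : E →L[ℂ] E} (hT : 0 ≤ T) :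
    Summable fun b => (⟪r b, T (r b)⟫_ℂ).re := by
  simpa only [norm_sqrt_apply_sq hT] using (h.comp (CFC.sqrt T)).1

/-- Duality, `tr(ρ Φ(T)) = tr(M(ρ) T) = tr(ρ T)` with `Φ` the dual map. Inserting `√T` turns both
traces into sums of squared norms. -/
theorem Represents.hasSum_re_inner_dualMap (hK : IsKrausFamily K) (h : Represents r ρ)
    (hρ : _root_.krausMap K ρ = ρ) {T : E →L[ℂ] E} (hT : 0 ≤ T) :
    HasSum (fun b => (⟪r b, hK.dualMap T (r b)⟫_ℂ).re) (∑' b, (⟪r b, T (r b)⟫_ℂ).re) := by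
  have h1 := (h.krausMap hK).comp (CFC.sqrt T)
  have h2 := h.comp (CFC.sqrt T)
  rw [hρ] at h1
  have h3 : HasSum (fun q : β × ι => ‖CFC.sqrt T (K q.2 (r q.1))‖ ^ 2)
      (∑' b, ‖CFC.sqrt T (r b)‖ ^ 2) := by
    rw [← h1.tsum_eq h2]
    exact (Equiv.prodComm β ι).hasSum_iff.mpr h1.1.hasSum
  simp only [norm_sqrt_apply_sq hT] at h3
  exact h3.prod_fiberwise fun b => Complex.hasSum_re (hK.hasSum_dualMap T (r b) (r b))

namespace IsKrausFamily

theorem dualMap_iterate_nonneg (hK : IsKrausFamily K) {T : E →L[ℂ] E} (hT : 0 ≤ T) (k : ℕ) :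
    0 ≤ hK.dualMap^[k] T := by
  induction k with
  | zero => exact hT
  | succ k ih =>
    rw [Function.iterate_succ_apply']
    exact hK.dualMap_nonneg ih

theorem norm_dualMap_iterate_le (hK : IsKrausFamily K) (T : E →L[ℂ] E) (k : ℕ) :
    ‖hK.dualMap^[k] T‖ ≤ ‖T‖ := by
  induction k with
  | zero => exact le_rfl
  | succ k ih =>
    rw [Function.iterate_succ_apply']
    exact (hK.norm_dualMap_le _).trans ih

theorem hasSum_re_inner_iterate (hK : IsKrausFamily K) {T : E →L[ℂ] E} (hT : 0 ≤ T)
    (h : Represents r ρ) (hρ : krausMap K ρ = ρ) (k : ℕ) :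
    HasSum (fun b => (⟪r b, (hK.dualMap^[k] T) (r b)⟫_ℂ).re) (∑' b, (⟪r b, T (r b)⟫_ℂ).re) := by
  induction k with
  | zero => exact (h.summable_re_inner hT).hasSum
  | succ k ih =>
    rw [Function.iterate_succ_apply', ← ih.tsum_eq]
    exact h.hasSum_re_inner_dualMap hK hρ (hK.dualMap_iterate_nonneg hT k)

/-- The Cesàro means of the iterates of the dual map. -/
noncomputable def cesaro (hK : IsKrausFamily K) (T : E →L[ℂ] E) (n : ℕ) : E →L[ℂ] E :=
  (((n + 1 : ℝ)⁻¹ : ℝ) : ℂ) • ∑ k ∈ Finset.range (n + 1), hK.dualMap^[k] T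

theorem cesaro_nonneg (hK : IsKrausFamily K) {T : E →L[ℂ] E} (hT : 0 ≤ T) (n : ℕ) :
    0 ≤ hK.cesaro T n := by
  unfold cesaro
  rw [Complex.coe_smul]
  exact smul_nonneg (by positivity) (Finset.sum_nonneg fun k _ => hK.dualMap_iterate_nonneg hT k)

theorem norm_cesaro_le (hK : IsKrausFamily K) (T : E →L[ℂ] E) (n : ℕ) : ‖hK.cesaro T n‖ ≤ ‖T‖ := by
  unfold cesaro
  rw [norm_smul, Complex.norm_real, Real.norm_of_nonneg (by positivity),
    inv_mul_le_iff₀ (by positivity)]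
  refine (norm_sum_le_of_le _ fun k _ => hK.norm_dualMap_iterate_le T k).trans_eq ?_
  simp

theorem hasSum_re_inner_cesaro (hK : IsKrausFamily K) {T : E →L[ℂ] E} (hT : 0 ≤ T)
    (h : Represents r ρ) (hρ : krausMap K ρ = ρ) (n : ℕ) :
    HasSum (fun b => (⟪r b, hK.cesaro T n (r b)⟫_ℂ).re) (∑' b, (⟪r b, T (r b)⟫_ℂ).re) := by
  have h1 := (hasSum_sum (s := Finset.range (n + 1)) fun k _ =>
    hK.hasSum_re_inner_iterate hT h hρ k).mul_left (n + 1 : ℝ)⁻¹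
  rw [Finset.sum_const, Finset.card_range, nsmul_eq_mul, ← mul_assoc, Nat.cast_add, Nat.cast_one,
    inv_mul_cancel₀ (by positivity), one_mul] at h1
  refine h1.congr_fun fun b => ?_
  unfold cesaro
  rw [smul_apply, inner_smul_right, Complex.re_ofReal_mul, sum_apply, inner_sum,
    Complex.re_sum]

theorem norm_dualMap_cesaro_sub_le (hK : IsKrausFamily K) (T : E →L[ℂ] E) (n : ℕ) :
    ‖hK.dualMap (hK.cesaro T n) - hK.cesaro T n‖ ≤ 2 * ‖T‖ * (1 / ((n : ℝ) + 1)) := by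
  let Φ : (E →L[ℂ] E) →ₗ[ℂ] (E →L[ℂ] E) := ⟨⟨hK.dualMap, hK.dualMap_add⟩, hK.dualMap_smul⟩
  have h1 : hK.dualMap (hK.cesaro T n) - hK.cesaro T n
      = (((n + 1 : ℝ)⁻¹ : ℝ) : ℂ) • (hK.dualMap^[n + 1] T - T) := by
    rw [cesaro, hK.dualMap_smul, ← smul_sub]
    congr 1
    have : hK.dualMap (∑ k ∈ Finset.range (n + 1), hK.dualMap^[k] T)
        = ∑ k ∈ Finset.range (n + 1), hK.dualMap^[k + 1] T := by
      simp only [Function.iterate_succ_apply']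
      exact map_sum Φ _ _
    rw [this, ← Finset.sum_sub_distrib]
    exact Finset.sum_range_sub (fun k => hK.dualMap^[k] T) (n + 1)
  rw [h1, norm_smul, Complex.norm_real, Real.norm_of_nonneg (by positivity), one_div, mul_comm]
  gcongr
  refine (norm_sub_le _ _).trans ?_
  linarith [hK.norm_dualMap_iterate_le T (n + 1)]

/-- `X` is a weak limit of the Cesàro means along an ultrafilter. Dominated convergence lets the
limit pass through the dual map (bound `‖T‖ ‖K p x‖²`) and through the trace against `ρ` (bound `‖T‖
‖r b‖²`); the first uses the telescoping estimate to give a fixed point. -/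
theorem exists_fixed_point.{w} (hK : IsKrausFamily K) {T : E →L[ℂ] E} (hT : 0 ≤ T) :
    ∃ X : E →L[ℂ] E, 0 ≤ X ∧ hK.dualMap X = X ∧
      ∀ (β : Type w) (r : β → E) (ρ : E →L[ℂ] E), Represents r ρ → krausMap K ρ = ρ →
        HasSum (fun b => (⟪r b, X (r b)⟫_ℂ).re) (∑' b, (⟪r b, T (r b)⟫_ℂ).re) := by
  let U : Ultrafilter ℕ := Filter.hyperfilter ℕ
  have hU : (U : Filter ℕ) ≤ atTop := Nat.hyperfilter_le_atTop
  obtain ⟨X, hX⟩ := exists_tendsto_inner_of_bounded U (hK.norm_cesaro_le T)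
  have hX0 : 0 ≤ X := isPositive_of_tendsto_inner (hK.cesaro_nonneg hT) hX
  refine ⟨X, hX0, ?_, fun β r ρ h hρ => ?_⟩
  · refine Represents.eq_of_inner_self fun x => ?_
    have h1 : Tendsto (fun n => ⟪x, hK.dualMap (hK.cesaro T n) x⟫_ℂ) U
        (𝓝 ⟪x, hK.dualMap X x⟫_ℂ) := by
      simp only [← (hK.hasSum_dualMap _ x x).tsum_eq]
      refine tendsto_tsum_of_dominated_convergence ((hK x).summable.mul_left ‖T‖)
        (fun p => hX _ _) (Eventually.of_forall fun n p => ?_)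
      refine (norm_inner_le_norm _ _).trans ?_
      calc ‖K p x‖ * ‖hK.cesaro T n (K p x)‖ ≤ ‖K p x‖ * (‖T‖ * ‖K p x‖) := by
            gcongr
            exact (hK.cesaro T n).le_of_opNorm_le (hK.norm_cesaro_le T n) _
        _ = _ := by ring
    have h2 : Tendsto (fun n => ⟪x, (hK.dualMap (hK.cesaro T n) - hK.cesaro T n) x⟫_ℂ) U (𝓝 0) := by
      have h3 : Tendsto (fun n : ℕ => ‖x‖ * (2 * ‖T‖ * (1 / ((n : ℝ) + 1)) * ‖x‖)) U (𝓝 0) := by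
        have := ((tendsto_one_div_add_atTop_nhds_zero_nat (𝕜 := ℝ)).const_mul
          (2 * ‖T‖)).mul_const ‖x‖ |>.const_mul ‖x‖
        simp only [mul_zero, zero_mul] at this
        exact this.mono_left hU
      refine squeeze_zero_norm (fun n => (norm_inner_le_norm _ _).trans ?_) h3
      gcongr
      exact ContinuousLinearMap.le_of_opNorm_le _ (hK.norm_dualMap_cesaro_sub_le T n) x
    have h4 := h1.sub (hX x x)
    simp only [sub_apply, inner_sub_right] at h2
    exact sub_eq_zero.1 (tendsto_nhds_unique h4 h2)
  · have h1 : Tendsto (fun n => ∑' b, (⟪r b, hK.cesaro T n (r b)⟫_ℂ).re) U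
        (𝓝 (∑' b, (⟪r b, X (r b)⟫_ℂ).re)) := by
      refine tendsto_tsum_of_dominated_convergence (h.1.mul_left ‖T‖)
        (fun b => (Complex.continuous_re.tendsto _).comp (hX _ _))
        (Eventually.of_forall fun n b => ?_)
      refine (Complex.abs_re_le_norm _).trans ((norm_inner_le_norm _ _).trans ?_)
      calc ‖r b‖ * ‖hK.cesaro T n (r b)‖ ≤ ‖r b‖ * (‖T‖ * ‖r b‖) := by
            gcongr
            exact (hK.cesaro T n).le_of_opNorm_le (hK.norm_cesaro_le T n) _
        _ = _ := by ring
    simp only [(hK.hasSum_re_inner_cesaro hT h hρ _).tsum_eq] at h1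
    rw [tendsto_nhds_unique tendsto_const_nhds h1]
    exact (h.summable_re_inner hX0).hasSum

end IsKrausFamily

end Cesaro

/-! ### Existence of minimal invariant subspaces -/

section Minimal

variable {E : Type*} [NormedAddCommGroup E] [InnerProductSpace ℂ E] [CompleteSpace E]

/-- `Y` is the positive part of `X - c`. The second property bounds `X` below by `c` on the range of
`Y`; the third shows `Y ≠ 0` as soon as `X` exceeds `c` somewhere. -/
theorem exists_threshold {X : E →L[ℂ] E} (hX : IsSelfAdjoint X) (c : ℝ) :
    ∃ Y : E →L[ℂ] E, 0 ≤ Y ∧ (∀ x, X (Y x) = (c : ℂ) • Y x + Y (Y x)) ∧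
      (∀ x, (⟪x, X x⟫_ℂ).re ≤ c * ‖x‖ ^ 2 + (⟪x, Y x⟫_ℂ).re) ∧
      ∀ B, Commute X B → Commute Y B := by
  let f : ℝ → ℝ := fun t => max (t - c) 0
  have hf : Continuous f := by fun_prop
  have hid : cfc (fun t : ℝ => t) X = X := cfc_id' ℝ X
  have hc : cfc (fun _ : ℝ => c) X = algebraMap ℝ (E →L[ℂ] E) c := cfc_const c X
  have hca : ∀ x, algebraMap ℝ (E →L[ℂ] E) c x = (c : ℂ) • x := fun x => by
    rw [Algebra.algebraMap_eq_smul_one, Complex.coe_smul]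
    rfl
  refine ⟨cfc f X, cfc_nonneg fun t _ => le_max_right _ _, fun x => ?_, fun x => ?_, fun B hB => ?_⟩
  · have h1 : X * cfc f X = algebraMap ℝ (E →L[ℂ] E) c * cfc f X + cfc f X * cfc f X := by
      nth_rewrite 1 [← hid]
      rw [← hc, ← cfc_mul _ _ X, ← cfc_mul _ _ X, ← cfc_mul _ _ X, ← cfc_add X _ _]
      refine cfc_congr fun t _ => ?_
      simp only [f]
      rcases le_total (t - c) 0 with h | h
      · simp [max_eq_right h]
      · rw [max_eq_left h]
        ring
    have h2 := congrArg (fun T : E →L[ℂ] E => T x) h1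
    simpa only [mul_apply_eq_comp, add_apply, hca] using h2
  · have h1 : 0 ≤ algebraMap ℝ (E →L[ℂ] E) c + cfc f X - X := by
      nth_rewrite 2 [← hid]
      rw [← hc, ← cfc_add X _ _, ← cfc_sub _ _ X]
      refine cfc_nonneg fun t _ => ?_
      have : t - c ≤ f t := le_max_left _ _
      linarith
    have h2 := ((ContinuousLinearMap.nonneg_iff_isPositive _).1 h1).re_inner_nonneg_right x
    rw [sub_apply, add_apply, hca, inner_sub_right, inner_add_right, inner_smul_right,
      inner_self_eq_ofReal, ← Complex.ofReal_mul] at h2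
    simp only [map_sub, map_add, RCLike.re_to_complex, Complex.ofReal_re] at h2
    linarith
  · exact hB.cfc_real f

variable {ι : Type*} {K : ι → E →L[ℂ] E} {β : Type*} {r : β → E} {ρ : E →L[ℂ] E}

/-- For `r ∈ W` the cross terms reduce to `⟨K_p X' r, X K_p r⟩` with `X' = P X P`, and these sum to
`⟨X' r, X r⟩ = ‖X' r‖²` because `X` is fixed by the dual map. -/
theorem IsInvariantSubspace.compression_comm (hK : IsKrausFamily K) {W : Submodule ℂ E}
    (hW : IsInvariantSubspace K W) [W.HasOrthogonalProjection] (h : Represents r ρ)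
    (hρ : krausMap K ρ = ρ) (hs : opSupport ρ ≤ W) {X : E →L[ℂ] E}
    (hX : hK.dualMap X = X) (p : ι) {x : E} (hx : x ∈ opSupport ρ) :
    W.starProjection (X (W.starProjection (K p x)))
      = K p (W.starProjection (X (W.starProjection x))) := by
  let X' : E →L[ℂ] E := W.starProjection.comp (X.comp W.starProjection)
  refine h.commute_of_hasSum hK hρ X' (fun b => ?_) p hx
  have hP : ∀ y ∈ W, W.starProjection y = y := fun y hy => Submodule.starProjection_eq_self_iff.2 hy
  have hr : r b ∈ W := hs (h.mem_opSupport b)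
  have hm : ∀ y, X' y ∈ W := fun y => Submodule.starProjection_apply_mem _ _
  have h1 := hK.hasSum_dualMap X (X' (r b)) (r b)
  have h2 : ⟪X' (r b), hK.dualMap X (r b)⟫_ℂ = ((‖X' (r b)‖ ^ 2 : ℝ) : ℂ) := by
    have h3 : X' (r b) = W.starProjection (X (r b)) := by
      change W.starProjection (X (W.starProjection (r b))) = _
      rw [hP _ hr]
    rw [hX, ← inner_self_eq_ofReal, h3, ← Submodule.inner_starProjection_left_eq_right,
      hP _ (Submodule.starProjection_apply_mem _ _)]
  rw [h2] at h1
  have h3 := Complex.hasSum_re h1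
  rw [Complex.ofReal_re] at h3
  refine h3.congr_fun fun p => ?_
  rw [← inner_conj_symm, Complex.conj_re]
  conv_lhs => rw [show X' (K p (r b)) = W.starProjection (X (W.starProjection (K p (r b)))) from rfl]
  rw [← Submodule.inner_starProjection_left_eq_right, hP _ (hW.2 p _ (hm _)), hP _ (hW.2 p _ hr)]

/-- A nonzero invariant subspace containing no others but `0` and itself. -/
def IsMinimalInvariantSubspace (K : ι → E →L[ℂ] E) (W : Submodule ℂ E) : Prop :=
  IsInvariantSubspace K W ∧ W ≠ ⊥ ∧ ∀ W', IsInvariantSubspace K W' → W' ≤ W → W' = ⊥ ∨ W' = W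

/-- `W` is the closed range of the cutoff of the compressed fixed point at `c = t / 2`. For an
invariant `W' ≤ W` with projection `Q`, the compression `Q ρ Q` is invariant, so `c tr(QρQ) ≤ tr(QρQ
X) = ⟨v, QρQ v⟩ ≤ ‖Q v‖² tr(QρQ)`, and the trace is positive when `W' ≠ ⊥`. -/
theorem exists_norm_starProjection_sq_ge (hK : IsKrausFamily K) (hρ : IsState ρ)
    (hi : krausMap K ρ = ρ) :
    ∃ (W : Submodule ℂ E) (v : E) (c : ℝ), IsInvariantSubspace K W ∧ W ≠ ⊥ ∧ W ≤ opSupport ρ ∧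
      0 < c ∧ ∀ (W' : Submodule ℂ E) [W'.HasOrthogonalProjection], IsInvariantSubspace K W' →
        W' ≤ W → W' ≠ ⊥ → c ≤ ‖W'.starProjection v‖ ^ 2 := by
  obtain ⟨w, b, -⟩ := exists_hilbertBasis ℂ E
  have hr := represents_sqrt hρ.1 b hρ.2.1
  set r : w → E := fun e => CFC.sqrt ρ (b e)
  have htr : ∑' e, ‖r e‖ ^ 2 = 1 := by
    exact_mod_cast (hr.hasSum_trace_complex b).unique (hρ.2.2 w b)
  obtain ⟨e₀, he₀⟩ : ∃ e, r e ≠ 0 := by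
    by_contra! h
    simp [h] at htr
  have hinv := hr.isInvariantSubspace hK hi
  have := hinv.completeSpace
  set W₁ := opSupport ρ
  set P := W₁.starProjection
  have hPW : ∀ y ∈ W₁, P y = y := fun y hy => Submodule.starProjection_eq_self_iff.2 hy
  have hPm : ∀ y, P y ∈ W₁ := fun y => Submodule.starProjection_apply_mem _ _
  set v := r e₀
  have hT : 0 ≤ InnerProductSpace.rankOne ℂ v v :=
    (ContinuousLinearMap.nonneg_iff_isPositive _).2 (represents_single v).isPositive
  have hTv : ∀ x, (⟪x, InnerProductSpace.rankOne ℂ v v x⟫_ℂ).re = ‖⟪v, x⟫_ℂ‖ ^ 2 := fun x =>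
    ((represents_single v).re_hasSum x).unique (hasSum_unique _)
  obtain ⟨X, hX0, hXfix, hXtr⟩ := hK.exists_fixed_point hT
  simp only [hTv] at hXtr
  set t := ∑' e, ‖⟪v, r e⟫_ℂ‖ ^ 2
  have hXr := hXtr w r ρ hr hi
  -- `t = ⟨v, ρ v⟩`, whose term at `e₀` is `‖v‖⁴`.
  have ht : 0 < t := by
    refine (hr.re_hasSum v |>.summable.congr fun e => ?_).tsum_pos (fun _ => by positivity) e₀ ?_
    · rw [norm_inner_symm]
    · have : ⟪v, r e₀⟫_ℂ ≠ 0 := inner_self_ne_zero.2 he₀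
      positivity
  -- As `tr(ρ X) = t` and `tr ρ = 1`, the form of `X` cannot stay below `t / 2` on every `r e`; this
  -- vector will show that the cutoff is nonzero.
  obtain ⟨e₁, he₁⟩ : ∃ e, t / 2 * ‖r e‖ ^ 2 < (⟪r e, X (r e)⟫_ℂ).re := by
    by_contra! h
    have h1 := hasSum_le h hXr (hr.1.hasSum.mul_left (t / 2))
    rw [htr] at h1
    linarith
  let X' : E →L[ℂ] E := P.comp (X.comp P)
  have hXsa : IsSelfAdjoint X' := by
    have h1 : IsSelfAdjoint P := isSelfAdjoint_starProjection W₁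
    have h2 := (IsSelfAdjoint.of_nonneg hX0).conjugate_self h1
    rwa [mul_assoc] at h2
  have hX'P : ∀ x, X' (P x) = X' x := fun x => by
    change P (X (P (P x))) = P (X (P x))
    rw [hPW _ (hPm x)]
  have hX'in : ∀ x ∈ W₁, ⟪x, X' x⟫_ℂ = ⟪x, X x⟫_ℂ := fun x hx => by
    change ⟪x, P (X (P x))⟫_ℂ = _
    rw [← Submodule.inner_starProjection_left_eq_right, hPW x hx]
  obtain ⟨Y, hY0, hXY, hXle, hYc⟩ := exists_threshold hXsa (t / 2)
  have hYP : ∀ x, Y (P x) = P (Y x) := fun x => by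
    have : Commute Y P := hYc P (ContinuousLinearMap.ext fun x => by
      change X' (P x) = P (P (X (P x)))
      rw [hX'P, hPW _ (hPm _)]
      rfl)
    exact congrArg (fun T : E →L[ℂ] E => T x) this
  have hYK : ∀ p x, Y (K p (P x)) = K p (P (Y x)) := fun p x => by
    have : Commute Y ((K p).comp P) := hYc _ (ContinuousLinearMap.ext fun x => by
      change X' (K p (P x)) = K p (P (P (X (P x))))
      rw [hPW _ (hPm _)]
      refine (hinv.compression_comm hK hr hi le_rfl hXfix p (hPm x)).trans ?_
      rw [hPW _ (hPm x)])
    exact congrArg (fun T : E →L[ℂ] E => T x) this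
  set R : Submodule ℂ E := LinearMap.range (Y.comp P).toLinearMap
  have hR : ∀ x, Y (P x) ∈ R := fun x => ⟨x, rfl⟩
  have hRW : R ≤ W₁ := by
    rintro _ ⟨x, rfl⟩
    change Y (P x) ∈ W₁
    rw [hYP]
    exact hPm _
  have hcl : R.topologicalClosure ≤ W₁ := Submodule.topologicalClosure_minimal _ hRW hinv.1
  have hlow : ∀ x ∈ R.topologicalClosure, t / 2 * ‖x‖ ^ 2 ≤ (⟪x, X x⟫_ℂ).re := by
    have h1 : IsClosed {x : E | t / 2 * ‖x‖ ^ 2 ≤ (⟪x, X x⟫_ℂ).re} :=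
      isClosed_le (by fun_prop) (by fun_prop)
    have h2 : (R : Set E) ⊆ {x : E | t / 2 * ‖x‖ ^ 2 ≤ (⟪x, X x⟫_ℂ).re} := by
      rintro _ ⟨x, rfl⟩
      change t / 2 * ‖Y (P x)‖ ^ 2 ≤ (⟪Y (P x), X (Y (P x))⟫_ℂ).re
      rw [← hX'in _ (hRW (hR x)), hXY, inner_add_right, inner_smul_right, inner_self_eq_ofReal,
        ← Complex.ofReal_mul, Complex.add_re, Complex.ofReal_re]
      exact le_add_of_nonneg_right
        (((ContinuousLinearMap.nonneg_iff_isPositive _).1 hY0).re_inner_nonneg_right _)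
    exact closure_minimal h2 h1
  refine ⟨R.topologicalClosure, v, t / 2, ⟨Submodule.isClosed_topologicalClosure _, fun p x hx =>
    (K p).map_mem_of_mem_closure (Submodule.isClosed_topologicalClosure _) ?_ hx⟩, fun hbot => ?_,
    hcl, by positivity, fun W' _ hW' hle hne => ?_⟩
  · rintro _ ⟨x, rfl⟩
    refine Submodule.le_topologicalClosure _ ⟨K p (P x), ?_⟩
    change Y (P (K p (P x))) = K p (Y (P x))
    rw [hPW _ (hinv.2 p _ (hPm x)), hYK, hYP]
  · have h1 : Y (r e₁) = 0 := by
      have h2 := Submodule.le_topologicalClosure R (hR (r e₁))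
      rwa [hbot, Submodule.mem_bot, hPW _ (hr.mem_opSupport e₁)] at h2
    have h3 := hXle (r e₁)
    rw [h1, inner_zero_right, Complex.zero_re, hX'in _ (hr.mem_opSupport e₁)] at h3
    linarith
  · set Q := W'.starProjection
    have hQm : ∀ y, Q y ∈ W' := fun y => Submodule.starProjection_apply_mem _ _
    have h1 := hr.comp Q
    have h2 := hXtr w _ _ h1 (hW'.krausMap_compression hK hr hi)
    have h3 : 0 < ∑' e, ‖Q (r e)‖ ^ 2 := by
      obtain ⟨e, he⟩ : ∃ e, Q (r e) ≠ 0 := by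
        by_contra! h
        have h4 : W₁ ≤ W'ᗮ := hr.opSupport_le (Submodule.isClosed_orthogonal _) fun e =>
          (Submodule.starProjection_apply_eq_zero_iff W').1 (h e)
        exact hne (Submodule.isOrtho_self.1 ((hle.trans hcl).trans h4))
      exact h1.1.tsum_pos (fun _ => by positivity) e (by positivity)
    have h4 := hasSum_le (fun e => hlow _ (hle (hQm (r e)))) (h1.1.hasSum.mul_left (t / 2)) h2
    have h5 : ∀ e, ‖⟪v, Q (r e)⟫_ℂ‖ ^ 2 ≤ ‖Q v‖ ^ 2 * ‖Q (r e)‖ ^ 2 := fun e => by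
      rw [← mul_pow, ← Submodule.starProjection_eq_self_iff.2 (hQm (r e)),
        ← Submodule.inner_starProjection_left_eq_right,
        Submodule.starProjection_eq_self_iff.2 (hQm (r e))]
      exact pow_le_pow_left₀ (norm_nonneg _) (norm_inner_le_norm _ _) 2
    have h6 := Summable.tsum_le_tsum h5 (.of_nonneg_of_le (fun _ => by positivity) h5
      (h1.1.mul_left _)) (h1.1.mul_left _)
    rw [tsum_mul_left] at h6
    exact le_of_mul_le_mul_right (h4.trans h6) h3

theorem norm_starProjection_sq_add_le {U V W : Submodule ℂ E} [U.HasOrthogonalProjection]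
    [V.HasOrthogonalProjection] [W.HasOrthogonalProjection] (hU : U ≤ W) (hV : V ≤ W) (h : U ⟂ V)
    (v : E) : ‖U.starProjection v‖ ^ 2 + ‖V.starProjection v‖ ^ 2 ≤ ‖W.starProjection v‖ ^ 2 := by
  set x := U.starProjection v
  set y := V.starProjection v
  have hx : x ∈ U := Submodule.starProjection_apply_mem _ _
  have hy : y ∈ V := Submodule.starProjection_apply_mem _ _
  have hself : ∀ (S : Submodule ℂ E) [S.HasOrthogonalProjection],
      ⟪S.starProjection v, v⟫_ℂ = ((‖S.starProjection v‖ ^ 2 : ℝ) : ℂ) := fun S _ => by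
    rw [← inner_self_eq_ofReal, ← Submodule.inner_starProjection_left_eq_right,
      Submodule.starProjection_eq_self_iff.2 (Submodule.starProjection_apply_mem _ _)]
  have h1 : ‖x + y‖ ^ 2 = ‖x‖ ^ 2 + ‖y‖ ^ 2 := by
    have := norm_add_sq_eq_norm_sq_add_norm_sq_of_inner_eq_zero (𝕜 := ℂ) x y (h.inner_eq hx hy)
    simpa only [sq] using this
  have h2 : ⟪x + y, W.starProjection v⟫_ℂ = ((‖x + y‖ ^ 2 : ℝ) : ℂ) := by
    rw [← Submodule.inner_starProjection_left_eq_right,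
      Submodule.starProjection_eq_self_iff.2 (W.add_mem (hU hx) (hV hy)), inner_add_left, hself,
      hself, h1, Complex.ofReal_add]
  have h3 := norm_inner_le_norm (𝕜 := ℂ) (x + y) (W.starProjection v)
  rw [h2, Complex.norm_real, Real.norm_of_nonneg (by positivity), sq] at h3
  rw [← h1]
  rcases (norm_nonneg (x + y)).eq_or_lt with h0 | h0
  · rw [← h0, zero_pow two_ne_zero]
    positivity
  · exact pow_le_pow_left₀ h0.le (le_of_mul_le_mul_left h3 h0) 2

/-- Take `W'` whose `‖P v‖²` is within less than `c` of the infimum. A proper nonzero invariant `W''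
< W'` would leave a nonzero invariant complement inside `W'`: the complement contributes at least
`c` and `W''` at least the infimum, which is too much. -/
theorem exists_isMinimalInvariantSubspace_le (hK : IsKrausFamily K) {W : Submodule ℂ E}
    (hW : IsInvariantSubspace K W) (h : ¬ W ⟂ recurrentSpace K) :
    ∃ W' ≤ W, IsMinimalInvariantSubspace K W' := by
  obtain ⟨ρ, hρ, hs⟩ := hW.exists_state hK h
  obtain ⟨W₀, v, c, hinv, hne, hle, hc, hv⟩ := exists_norm_starProjection_sq_ge hK hρ.1 hρ.2
  let S : Set ℝ := {t | ∃ (W' : Submodule ℂ E) (_ : W'.HasOrthogonalProjection),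
    IsInvariantSubspace K W' ∧ W' ≤ W₀ ∧ W' ≠ ⊥ ∧ t = ‖W'.starProjection v‖ ^ 2}
  have hbdd : BddBelow S := ⟨0, by rintro _ ⟨W', _, -, -, -, rfl⟩; positivity⟩
  have hS : S.Nonempty := by
    have := hinv.completeSpace
    exact ⟨_, W₀, inferInstance, hinv, le_rfl, hne, rfl⟩
  obtain ⟨_, ⟨W', _, hW', hW'le, hW'ne, rfl⟩, hlt⟩ :=
    exists_lt_of_csInf_lt hS (lt_add_of_pos_right (sInf S) hc)
  refine ⟨W', (hW'le.trans hle).trans hs, hW', hW'ne, fun W'' hW'' hle'' => ?_⟩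
  by_contra! hcon
  have hR := hW''.recurrentSpace_inf_orthogonal hK
  have h3 := hW'.inf hR
  have := h3.completeSpace
  have := hW''.completeSpace
  have hne3 : W' ⊓ (recurrentSpace K ⊓ W''ᗮ) ≠ ⊥ := fun hbot => by
    refine hcon.2 ?_
    have h4 : W' ≤ recurrentSpace K :=
      (hW'le.trans hle).trans (opSupport_le_recurrentSpace hρ)
    rw [← inf_assoc, inf_eq_left.2 h4] at hbot
    have := Submodule.sup_orthogonal_inf_of_hasOrthogonalProjection hle''
    rwa [inf_comm, hbot, sup_bot_eq] at this
  have h5 := norm_starProjection_sq_add_le hle'' (inf_le_left : W' ⊓ (recurrentSpace K ⊓ W''ᗮ) ≤ W')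
    ((Submodule.isOrtho_orthogonal_right W'').mono_right (inf_le_right.trans inf_le_right)) v
  have h6 := hv _ h3 (inf_le_left.trans hW'le) hne3
  have h7 : sInf S ≤ ‖W''.starProjection v‖ ^ 2 :=
    csInf_le hbdd ⟨W'', inferInstance, hW'', hle''.trans hW'le, hcon.1, rfl⟩
  linarith

end Minimal

/-! ### Orthogonal families of minimal subspaces -/

section Decomposition

variable {E : Type*} [NormedAddCommGroup E] [InnerProductSpace ℂ E]

/-- Unit vectors from distinct members are `√2` apart, so balls of radius `1 / 2` around them are
disjoint open sets. -/
theorem countable_of_pairwise_isOrtho [TopologicalSpace.SeparableSpace E]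
    {F : Set (Submodule ℂ E)} (hne : ∀ W ∈ F, W ≠ ⊥) (h : F.Pairwise (· ⟂ ·)) : F.Countable := by
  have hv : ∀ W : Submodule ℂ E, ∃ v : E, W ∈ F → v ∈ W ∧ ‖v‖ = 1 := fun W => by
    by_cases hW : W ∈ F
    · obtain ⟨x, hx, hx0⟩ := Submodule.exists_mem_ne_zero_of_ne_bot (hne W hW)
      refine ⟨((‖x‖⁻¹ : ℝ) : ℂ) • x, fun _ => ⟨W.smul_mem _ hx, ?_⟩⟩
      rw [norm_smul, Complex.norm_real, norm_inv, norm_norm, inv_mul_cancel₀ (norm_ne_zero_iff.2 hx0)]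
    · exact ⟨0, fun h => absurd h hW⟩
  choose v hv using hv
  refine Set.PairwiseDisjoint.countable_of_isOpen (s := fun W => Metric.ball (v W) (1 / 2))
    (fun W hW W' hW' hne => ?_) (fun _ _ => Metric.isOpen_ball)
    fun W _ => ⟨v W, Metric.mem_ball_self (by norm_num)⟩
  refine Metric.ball_disjoint_ball ?_
  have h1 : ‖v W - v W'‖ ^ 2 = 2 := by
    rw [norm_sub_sq (𝕜 := ℂ), (h hW hW' hne).inner_eq (hv W hW).1 (hv W' hW').1, (hv W hW).2,
      (hv W' hW').2]
    norm_num
  rw [dist_eq_norm]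
  nlinarith [norm_nonneg (v W - v W')]

variable [CompleteSpace E]

/-- The residual of `w` after projection to the span over `t` is orthogonal to every `G n`, yet lies
in their closed span, so it vanishes. -/
theorem le_closure_iSup_of_isOrtho {N : Type*} {G : N → Submodule ℂ E}
    (hG : Pairwise fun n m => G n ⟂ G m) (t : Set N) {W : Submodule ℂ E}
    (hW : W ≤ (⨆ n, G n).topologicalClosure) (ht : ∀ n ∉ t, W ⟂ G n) :
    W ≤ (⨆ n : t, G n).topologicalClosure := by
  intro w hw
  set S := (⨆ n : t, G n).topologicalClosure with hS
  have : CompleteSpace S := (Submodule.isClosed_topologicalClosure _).completeSpace_coe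
  have hGS : ∀ n ∈ t, G n ≤ S := fun n hn =>
    (le_iSup (fun n : t => G n) ⟨n, hn⟩).trans (Submodule.le_topologicalClosure _)
  set y := w - S.starProjection w
  have hy : y ∈ Sᗮ := S.sub_starProjection_mem_orthogonal w
  have hSG : S ≤ (⨆ n, G n).topologicalClosure :=
    Submodule.topologicalClosure_mono (iSup_le fun n => le_iSup G n)
  have hyG : ∀ n, G n ≤ (ℂ ∙ y)ᗮ := fun n => by
    refine Submodule.isOrtho_iff_le.1 (Submodule.isOrtho_comm.1 ?_)
    by_cases hn : n ∈ t
    · refine Submodule.isOrtho_iff_le.2 ((Submodule.span_singleton_le_iff_mem _ _).2 ?_)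
      exact Submodule.orthogonal_le (hGS n hn) hy
    · refine Submodule.isOrtho_iff_le.2 ((Submodule.span_singleton_le_iff_mem _ _).2 ?_)
      refine Submodule.sub_mem _ (Submodule.isOrtho_iff_le.1 (ht n hn) hw) ?_
      have h1 : S ≤ (G n)ᗮ := Submodule.topologicalClosure_minimal _
        (iSup_le fun m => Submodule.isOrtho_iff_le.1 (hG fun h => hn (h ▸ m.2)))
        (Submodule.isClosed_orthogonal _)
      exact h1 (Submodule.starProjection_apply_mem _ _)
  have h2 : (⨆ n, G n).topologicalClosure ≤ (ℂ ∙ y)ᗮ :=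
    Submodule.topologicalClosure_minimal _ (iSup_le hyG) (Submodule.isClosed_orthogonal _)
  have h3 : y ∈ (ℂ ∙ y)ᗮ :=
    h2 (Submodule.sub_mem _ (hW hw) (hSG (Submodule.starProjection_apply_mem _ _)))
  have h4 : y = 0 := inner_self_eq_zero.1 (Submodule.mem_orthogonal_singleton_iff_inner_right.1 h3)
  rw [sub_eq_zero.1 h4]
  exact Submodule.starProjection_apply_mem _ _

variable {ι : Type*} {K : ι → E →L[ℂ] E}

theorem IsMinimalInvariantSubspace.le_recurrentSpace (hK : IsKrausFamily K) {W : Submodule ℂ E}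
    (hW : IsMinimalInvariantSubspace K W) (h : ¬ W ⟂ recurrentSpace K) : W ≤ recurrentSpace K := by
  rcases hW.2.2 _ (hW.1.inf (isInvariantSubspace_recurrentSpace hK)) inf_le_left with h1 | h1
  · exact absurd h1 (hW.1.inf_recurrentSpace_ne_bot hK h)
  · exact inf_eq_left.1 h1

/-- For a maximal orthogonal family inside `R`, the part of `R` orthogonal to it is invariant; if
nonzero it would contain a further minimal subspace. -/
theorem exists_orthogonal_minimal_family (hK : IsKrausFamily K) :
    ∃ F : Set (Submodule ℂ E), (∀ W ∈ F, IsMinimalInvariantSubspace K W) ∧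
      F.Pairwise (· ⟂ ·) ∧ (⨆ W : F, (W : Submodule ℂ E)).topologicalClosure = recurrentSpace K := by
  let 𝒮 : Set (Set (Submodule ℂ E)) := {F | (∀ W ∈ F, IsMinimalInvariantSubspace K W ∧
    W ≤ recurrentSpace K) ∧ F.Pairwise (· ⟂ ·)}
  obtain ⟨F, hF⟩ := zorn_subset 𝒮 fun c hc hchain => by
    refine ⟨⋃₀ c, ⟨?_, ?_⟩, fun s hs => Set.subset_sUnion_of_mem hs⟩
    · rintro W ⟨s, hs, hW⟩
      exact (hc hs).1 W hW
    · exact (Set.pairwise_sUnion hchain.directedOn).2 fun s hs => (hc hs).2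
  have hinv := IsInvariantSubspace.iSup_closure (K := K) (F := fun W : F => (W : Submodule ℂ E))
    fun W => (hF.prop.1 W W.2).1.1
  set G := (⨆ W : F, (W : Submodule ℂ E)).topologicalClosure with hG
  have hFG : ∀ W ∈ F, W ≤ G := fun W hW =>
    (le_iSup (fun W : F => (W : Submodule ℂ E)) ⟨W, hW⟩).trans (Submodule.le_topologicalClosure _)
  have hGR : G ≤ recurrentSpace K := Submodule.topologicalClosure_minimal _
    (iSup_le fun W => (hF.prop.1 W W.2).2) (isInvariantSubspace_recurrentSpace hK).1
  refine ⟨F, fun W hW => (hF.prop.1 W hW).1, hF.prop.2, ?_⟩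
  have hbot : recurrentSpace K ⊓ Gᗮ = ⊥ := by
    by_contra hne
    obtain ⟨W, hW, hmin⟩ := exists_isMinimalInvariantSubspace_le hK
      (hinv.recurrentSpace_inf_orthogonal hK)
      fun h => hne (Submodule.isOrtho_self.1 (h.mono_right inf_le_left))
    have hWF : ∀ W' ∈ F, W ⟂ W' := fun W' hW' =>
      Submodule.isOrtho_iff_le.2 ((hW.trans inf_le_right).trans (Submodule.orthogonal_le (hFG W' hW')))
    have h1 : insert W F ∈ 𝒮 := by
      refine ⟨?_, ?_⟩
      · rintro W' (rfl | hW')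
        · exact ⟨hmin, hW.trans inf_le_left⟩
        · exact hF.prop.1 W' hW'
      · refine hF.prop.2.insert fun W' hW' _ => ⟨hWF W' hW', (hWF W' hW').symm⟩
    have h2 : W ∈ F := hF.le_of_ge h1 (Set.subset_insert W F) (Set.mem_insert W F)
    exact hmin.2.1 (Submodule.isOrtho_self.1 (hWF W h2))
  have := hinv.completeSpace
  have h3 := Submodule.sup_orthogonal_inf_of_hasOrthogonalProjection hGR
  rwa [inf_comm, hbot, sup_bot_eq] at h3

end Decomposition

/-! ### Open quantum walks: enclosures and accessibility -/

namespace OQRW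

universe u v

variable {V : Type u} {h : V → Type v} [∀ i, NormedAddCommGroup (h i)]
  [∀ i, InnerProductSpace ℂ (h i)] [∀ i, CompleteSpace (h i)]

/-- The Kraus operators as a family indexed by pairs of sites. -/
noncomputable def krausFamily (M : OQRW h) (p : V × V) : WalkSpace h →L[ℂ] WalkSpace h :=
  M.kraus p.1 p.2

theorem block_apply {i j : V} (T : h i →L[ℂ] h j) (x : WalkSpace h) :
    block T x = site j (T (x i)) := rfl

theorem norm_site (i : V) (x : h i) : ‖site i x‖ = ‖x‖ := by
  classical
  unfold site
  convert lp.norm_single (E := h) (p := 2) (by simp) i x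

theorem site_apply_self (i : V) (x : h i) : site i x i = x := by
  classical
  unfold site
  exact Pi.single_eq_same i x

theorem site_apply_of_ne {i j : V} (hij : j ≠ i) (x : h i) : site i x j = 0 := by
  classical
  unfold site
  exact Pi.single_eq_of_ne hij x

theorem site_eq_zero {i : V} {x : h i} : site i x = 0 ↔ x = 0 := by
  rw [← norm_eq_zero, norm_site, norm_eq_zero]

theorem krausFamily_apply (M : OQRW h) (i j : V) (x : WalkSpace h) :
    M.krausFamily (i, j) x = site i (M.L i j (x j)) := rfl

theorem isKrausFamily (M : OQRW h) : IsKrausFamily M.krausFamily := by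
  intro x
  have h1 : ∀ j, HasSum (fun i => ‖M.L i j (x j)‖ ^ 2) (‖x j‖ ^ 2) := fun j => by
    have := Complex.hasSum_re ((M.stochastic j (x j)).mapL (innerSL ℂ (x j)))
    simpa only [innerSL_apply_apply, ContinuousLinearMap.adjoint_inner_right, inner_self_eq_ofReal,
      Complex.ofReal_re] using this
  have h2 : HasSum (fun j => ‖x j‖ ^ 2) (‖x‖ ^ 2) := by
    simpa using lp.hasSum_norm (p := 2) (by simp) x
  have h3 := hasSum_prod_of_nonneg (f := fun q : V × V => ‖M.L q.2 q.1 (x q.1)‖ ^ 2)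
    (fun _ => by positivity) h1 h2
  refine ((Equiv.prodComm V V).hasSum_iff.mpr h3).congr_fun fun p => ?_
  exact congrArg (fun t : ℝ => t ^ 2) (norm_site p.1 (M.L p.1 p.2 (x p.2)))

theorem isEnclosure_iff (M : OQRW h) {W : Submodule ℂ (WalkSpace h)} :
    M.IsEnclosure W ↔ IsInvariantSubspace M.krausFamily W :=
  isInvariantSubspace_iff M.isKrausFamily

theorem isMinimalEnclosure_iff (M : OQRW h) {W : Submodule ℂ (WalkSpace h)} :
    M.IsMinimalEnclosure W ↔ IsMinimalInvariantSubspace M.krausFamily W := by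
  unfold IsMinimalEnclosure IsMinimalInvariantSubspace
  simp only [isEnclosure_iff]

theorem isEnclosure_enc (M : OQRW h) (φ : WalkSpace h) :
    IsInvariantSubspace M.krausFamily (M.enc φ) := by
  refine ⟨Submodule.isClosed_topologicalClosure _, fun p x hx => ?_⟩
  obtain ⟨k, j'⟩ := p
  refine (M.krausFamily (k, j')).map_mem_of_mem_closure_span
    (Submodule.isClosed_topologicalClosure _) ?_ hx
  rintro _ ⟨i, j, π, rfl⟩
  rw [krausFamily_apply, block_apply]
  by_cases hj : j' = j
  · subst hj
    rw [site_apply_self]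
    exact Submodule.le_topologicalClosure _ (Submodule.subset_span ⟨i, k, π.snoc k, rfl⟩)
  · rw [site_apply_of_ne hj, map_zero, site_eq_zero.2 rfl]
    exact Submodule.zero_mem _

theorem site_apply_mem_enc (M : OQRW h) (φ : WalkSpace h) (i : V) : site i (φ i) ∈ M.enc φ :=
  Submodule.le_topologicalClosure _ (Submodule.subset_span ⟨i, i, SitePath.nil, rfl⟩)

theorem mem_enc_self (M : OQRW h) (φ : WalkSpace h) : φ ∈ M.enc φ := by
  classical
  refine (Submodule.isClosed_topologicalClosure _).mem_of_tendsto
    (lp.hasSum_single (by simp) φ) (Filter.Eventually.of_forall fun s => ?_)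
  exact Submodule.sum_mem _ fun i _ => M.site_apply_mem_enc φ i

theorem exists_apply_ne_zero {φ : WalkSpace h} (hφ : φ ≠ 0) : ∃ i, φ i ≠ 0 := by
  by_contra! hc
  exact hφ (lp.ext (funext hc))

theorem enc_zero (M : OQRW h) : M.enc 0 = ⊥ := by
  rw [eq_bot_iff]
  refine Submodule.topologicalClosure_minimal _ (Submodule.span_le.2 ?_) (by simp)
  rintro _ ⟨i, j, π, rfl⟩
  simp

variable {M : OQRW h} {W : Submodule ℂ (WalkSpace h)}

/-- The closed span `U` of all `K p w`, `w ∈ W`, is an enclosure inside `W`, and nonzero by the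
normalization, so minimality gives `U = W`. Its generators each sit at one site, hence extracting
the component at `i` keeps them or kills them. -/
theorem IsMinimalEnclosure.site_apply_mem (hW : M.IsMinimalEnclosure W) {x : WalkSpace h}
    (hx : x ∈ W) (i : V) : site i (x i) ∈ W := by
  obtain ⟨hinv, hne, hmin⟩ := M.isMinimalEnclosure_iff.1 hW
  let S : Set (WalkSpace h) := {y | ∃ p, ∃ w ∈ W, y = M.krausFamily p w}
  set U := (Submodule.span ℂ S).topologicalClosure with hU
  have hSU : ∀ p, ∀ w ∈ W, M.krausFamily p w ∈ U := fun p w hw =>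
    Submodule.le_topologicalClosure _ (Submodule.subset_span ⟨p, w, hw, rfl⟩)
  have hUW : U ≤ W := by
    refine Submodule.topologicalClosure_minimal _ (Submodule.span_le.2 ?_) hinv.1
    rintro _ ⟨p, w, hw, rfl⟩
    exact hinv.2 p w hw
  have hUinv : IsInvariantSubspace M.krausFamily U :=
    ⟨Submodule.isClosed_topologicalClosure _, fun p x hx => hSU p x (hUW hx)⟩
  rcases hmin U hUinv hUW with h0 | h0
  · refine absurd ((Submodule.eq_bot_iff W).2 fun w hw => ?_) hne
    have h1 := M.isKrausFamily w
    have h2 : ∀ p, M.krausFamily p w = 0 := fun p => by simpa [h0] using hSU p w hw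
    simpa [h2] using h1.unique (by simp [h2, hasSum_zero] : HasSum _ (0 : ℝ))
  · rw [← h0] at hx
    refine (block (ContinuousLinearMap.id ℂ (h i))).map_mem_of_mem_closure_span hinv.1 ?_ hx
    rintro _ ⟨⟨k, j⟩, w, hw, rfl⟩
    rw [krausFamily_apply, block_apply]
    by_cases hk : i = k
    · subst hk
      rw [site_apply_self]
      exact hinv.2 (i, j) w hw
    · rw [site_apply_of_ne hk, map_zero, site_eq_zero.2 rfl]
      exact W.zero_mem

theorem IsMinimalEnclosure.enc_le (hW : M.IsMinimalEnclosure W) {x : WalkSpace h} (hx : x ∈ W) :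
    M.enc x ≤ W := by
  have hinv := (M.isMinimalEnclosure_iff.1 hW).1
  refine Submodule.topologicalClosure_minimal _ (Submodule.span_le.2 ?_) hinv.1
  rintro _ ⟨i, j, π, rfl⟩
  induction π with
  | nil => exact hW.site_apply_mem hx i
  | @snoc j π k ih =>
    have h1 := hinv.2 (k, j) _ ih
    rwa [krausFamily_apply, block_apply, site_apply_self] at h1

theorem IsMinimalEnclosure.enc_eq (hW : M.IsMinimalEnclosure W) {x : WalkSpace h} (hx : x ∈ W)
    (hx0 : x ≠ 0) : M.enc x = W := by
  refine ((M.isMinimalEnclosure_iff.1 hW).2.2 _ (M.isEnclosure_enc x) (hW.enc_le hx)).resolve_left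
    fun hbot => hx0 ?_
  simpa [hbot] using M.mem_enc_self x

theorem IsMinimalEnclosure.exists_site (hW : M.IsMinimalEnclosure W) :
    ∃ (i : V) (x : h i), M.enc (site i x) = W := by
  obtain ⟨w, hw, hw0⟩ := Submodule.exists_mem_ne_zero_of_ne_bot hW.2.1
  obtain ⟨i, hi⟩ := exists_apply_ne_zero hw0
  exact ⟨i, w i, hW.enc_eq (hW.site_apply_mem hw i) fun h0 => hi (site_eq_zero.1 h0)⟩

theorem IsMinimalEnclosure.isCommunicationClass (hW : M.IsMinimalEnclosure W) :
    M.IsCommunicationClass ((W : Set (WalkSpace h)) \ {0}) := by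
  refine ⟨?_, fun φ hφ ψ => ?_⟩
  · obtain ⟨w, hw, hw0⟩ := Submodule.exists_mem_ne_zero_of_ne_bot hW.2.1
    exact ⟨w, hw, hw0⟩
  · have h1 := hW.enc_eq hφ.1 hφ.2
    constructor
    · rintro ⟨h2, h3⟩
      refine ⟨h1 ▸ h2, ?_⟩
      rintro rfl
      rw [enc_zero] at h3
      exact hφ.2 h3
    · rintro ⟨h2, h3⟩
      exact ⟨h1.symm ▸ h2, (hW.enc_eq h2 h3).symm ▸ hφ.1⟩

theorem separableSpace_walkSpace [Countable V] [∀ i, TopologicalSpace.SeparableSpace (h i)] :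
    TopologicalSpace.SeparableSpace (WalkSpace h) := by
  classical
  have h1 : TopologicalSpace.IsSeparable
      (⋃ i, Set.range (lp.singleContinuousLinearMap ℂ h 2 i)) :=
    TopologicalSpace.IsSeparable.iUnion fun i =>
      TopologicalSpace.isSeparable_range (ContinuousLinearMap.continuous _)
  have h2 := (h1.span (R := ℂ)).closure
  refine TopologicalSpace.isSeparable_univ_iff.1 (h2.mono fun x _ => ?_)
  refine mem_closure_of_tendsto (lp.hasSum_single (by simp) x)
    (Filter.Eventually.of_forall fun s => ?_)
  exact Submodule.sum_mem _ fun i _ => Submodule.subset_span (Set.mem_iUnion.2 ⟨i, x i, rfl⟩)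

end OQRW

/-! ### Assembling the decomposition -/

theorem isOrthogonalDecomposition_of_pairwise {ι : Type*} {E : Type*} [NormedAddCommGroup E]
    [InnerProductSpace ℂ E] [CompleteSpace E] {F : ι → Submodule ℂ E}
    (hc : ∀ k, IsClosed (F k : Set E)) (ho : Pairwise fun k l => F k ⟂ F l)
    (ht : (⨆ k, F k)ᗮ = ⊥) : IsOrthogonalDecomposition F := by
  have : ∀ k, CompleteSpace (F k) := fun k => (hc k).completeSpace_coe
  exact ⟨hc, IsHilbertSum.mkInternal F (OrthogonalFamily.of_pairwise ho)
    ((Submodule.topologicalClosure_eq_top_iff).2 ht).ge⟩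

theorem recurrentSpace_ne_bot_iff {E : Type*} [NormedAddCommGroup E]
    [InnerProductSpace ℂ E] [CompleteSpace E] {ι : Type*} {K : ι → E →L[ℂ] E}
    (hK : IsKrausFamily K) :
    recurrentSpace K ≠ ⊥ ↔ ∃ ρ : E →L[ℂ] E, IsState ρ ∧ krausMap K ρ = ρ := by
  refine ⟨fun h => ?_, ?_⟩
  · obtain ⟨ρ, hρ, -⟩ := (isInvariantSubspace_recurrentSpace hK).exists_state hK
      fun h0 => h (Submodule.isOrtho_self.1 h0)
    exact ⟨ρ, hρ⟩
  · rintro ⟨ρ, hρ⟩ hbot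
    obtain ⟨W, v, c, -, hne, hle, -⟩ := exists_norm_starProjection_sq_ge hK hρ.1 hρ.2
    exact hne (le_bot_iff.1 ((hle.trans (opSupport_le_recurrentSpace hρ)).trans hbot.le))

theorem mainTheorem2 {V : Type*} [Countable V] {h : V → Type*}
    [∀ i, NormedAddCommGroup (h i)] [∀ i, InnerProductSpace ℂ (h i)] [∀ i, CompleteSpace (h i)]
    [∀ i, TopologicalSpace.SeparableSpace (h i)] (M : OQRW h) :
    ∃ (A B : Type) (C : B → Type)
      (iA : A → V) (xA : ∀ a, h (iA a))
      (iB : ∀ b, C b → V) (xB : ∀ b (c : C b), h (iB b c)),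
      Countable A ∧ Countable B ∧ (∀ b, Countable (C b)) ∧ (∀ b, Nontrivial (C b)) ∧
      ((Nonempty A ∨ Nonempty B) ↔ ∃ ρ, M.IsInvariantState ρ) ∧
      IsOrthogonalDecomposition
        (Sum.elim (fun _ : Unit => M.decaying)
          (Sum.elim (fun a : A => M.enc (OQRW.site (iA a) (xA a)))
            (fun p : (b : B) × C b => M.enc (OQRW.site (iB p.1 p.2) (xB p.1 p.2))))) ∧
      (∀ a, M.IsMinimalEnclosure (M.enc (OQRW.site (iA a) (xA a))) ∧
        M.IsCommunicationClass
          ((M.enc (OQRW.site (iA a) (xA a)) : Set (WalkSpace h)) \ {0})) ∧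
      (∀ b c, M.IsMinimalEnclosure (M.enc (OQRW.site (iB b c) (xB b c))) ∧
        M.IsCommunicationClass
          ((M.enc (OQRW.site (iB b c) (xB b c)) : Set (WalkSpace h)) \ {0})) ∧
      (∀ a W, M.IsMinimalEnclosure W →
        (¬ W ⟂ M.enc (OQRW.site (iA a) (xA a)) ↔ W = M.enc (OQRW.site (iA a) (xA a)))) ∧
      (∀ b c W, M.IsMinimalEnclosure W → ¬ W ⟂ M.enc (OQRW.site (iB b c) (xB b c)) →
        W ≤ (⨆ c' : C b, M.enc (OQRW.site (iB b c') (xB b c'))).topologicalClosure) := by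
  have hK := M.isKrausFamily
  have := OQRW.separableSpace_walkSpace (h := h)
  obtain ⟨F, hmin, hpw, hsup⟩ := exists_orthogonal_minimal_family hK
  have hcount : Countable F :=
    (countable_of_pairwise_isOrtho (fun W hW => (hmin W hW).2.1) hpw).to_subtype
  -- Reindexing by a subset of `ℕ` brings the index types down to `Type`.
  obtain ⟨f, hf⟩ := Countable.exists_injective_nat F
  let e : F ≃ Set.range f := Equiv.ofInjective f hf
  let N : Type := Set.range f
  let G : N → Submodule ℂ (WalkSpace h) := fun n => (e.symm n : Submodule ℂ (WalkSpace h))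
  have hGmin : ∀ n, M.IsMinimalEnclosure (G n) := fun n =>
    M.isMinimalEnclosure_iff.2 (hmin _ (e.symm n).2)
  have hGpw : Pairwise fun n m => G n ⟂ G m := fun n m hnm =>
    hpw (e.symm n).2 (e.symm m).2 fun h => hnm (e.symm.injective (Subtype.ext h))
  have hGsup : (⨆ n, G n).topologicalClosure = recurrentSpace M.krausFamily := by
    rw [← hsup]
    congr 1
    exact e.symm.iSup_comp (g := fun W : F => (W : Submodule ℂ (WalkSpace h)))
  have hGle : ∀ n, G n ≤ recurrentSpace M.krausFamily := fun n =>
    hGsup ▸ (le_iSup G n).trans (Submodule.le_topologicalClosure _)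
  have hWle : ∀ W n, M.IsMinimalEnclosure W → ¬ W ⟂ G n → W ≤ (⨆ n, G n).topologicalClosure :=
    fun W n hW hn => hGsup ▸ (M.isMinimalEnclosure_iff.1 hW).le_recurrentSpace hK
      fun h0 => hn (h0.mono_right (hGle n))
  choose i x hix using fun n => (hGmin n).exists_site
  -- Taking the generated equivalence relation spares a proof of transitivity; `hclass` only needs
  -- that a minimal enclosure is orthogonal to all members outside a class it meets.
  let s : Setoid N := Relation.EqvGen.setoid fun n m =>
    ∃ W, M.IsMinimalEnclosure W ∧ ¬ W ⟂ G n ∧ ¬ W ⟂ G m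
  have hs : ∀ W n m, M.IsMinimalEnclosure W → ¬ W ⟂ G n → ¬ W ⟂ G m → s n m :=
    fun W n m hW hn hm => Relation.EqvGen.rel _ _ ⟨W, hW, hn, hm⟩
  have hclass : ∀ (t : Set N) W n, M.IsMinimalEnclosure W → ¬ W ⟂ G n → (∀ m, s n m → m ∈ t) →
      W ≤ (⨆ m : t, G m).topologicalClosure := fun t W n hW hn ht =>
    le_closure_iSup_of_isOrtho hGpw t (hWle W n hW hn) fun m hm => by
      by_contra hWm
      exact hm (ht m (hs W n m hW hn hWm))
  -- Singleton classes give `A`; classes with two distinct elements give `B`.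
  let A : Type := {n : N // ∀ m, s n m → m = n}
  let B : Type := {q : Quotient s // ∃ n m, n ≠ m ∧ Quotient.mk s n = q ∧ Quotient.mk s m = q}
  let C : B → Type := fun b => {n : N // Quotient.mk s n = b.1}
  let ν : A ⊕ ((b : B) × C b) → N := Sum.elim (fun a => a.1) fun p => p.2.1
  have hν : Function.Bijective ν := by
    constructor
    · rintro (⟨n, hn⟩ | ⟨⟨q, k, l, hkl, hk, hl⟩, n, hn⟩)
        (⟨n', hn'⟩ | ⟨⟨q', k', l', hkl', hk', hl'⟩, n', hn''⟩) hnn <;>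
        simp only [ν, Sum.elim_inl, Sum.elim_inr] at hnn <;> subst hnn
      · rfl
      · exact absurd ((hn _ (Quotient.exact (hn''.trans hk'.symm))).trans
          (hn _ (Quotient.exact (hn''.trans hl'.symm))).symm) hkl'
      · exact absurd ((hn' _ (Quotient.exact (hn.trans hk.symm))).trans
          (hn' _ (Quotient.exact (hn.trans hl.symm))).symm) hkl
      · change Quotient.mk s n = q at hn
        change Quotient.mk s n = q' at hn''
        subst hn
        subst hn''
        rfl
    · intro n
      by_cases hn : ∀ m, s n m → m = n
      · exact ⟨Sum.inl ⟨n, hn⟩, rfl⟩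
      · push Not at hn
        obtain ⟨m, hm, hne⟩ := hn
        exact ⟨Sum.inr ⟨⟨Quotient.mk s n, n, m, hne.symm, rfl, (Quotient.sound hm).symm⟩, n, rfl⟩, rfl⟩
  have hfam : Sum.elim (fun _ : Unit => M.decaying)
      (Sum.elim (fun a : A => G a.1) fun p : (b : B) × C b => G p.2.1)
      = Sum.elim (fun _ : Unit => M.decaying) (G ∘ ν) := by
    funext k
    rcases k with _ | _ | _ <;> rfl
  refine ⟨A, B, C, fun a => i a.1, fun a => x a.1, fun b c => i c.1, fun b c => x c.1,
    inferInstance, inferInstance, fun b => inferInstance, fun b => ?_, ?_, ?_, ?_, ?_, ?_, ?_⟩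
  · obtain ⟨q, n, m, hnm, hn, hm⟩ := b
    exact ⟨⟨n, hn⟩, ⟨m, hm⟩, fun h => hnm (congrArg Subtype.val h)⟩
  · refine Iff.trans ?_ (recurrentSpace_ne_bot_iff hK)
    constructor
    · intro hAB
      obtain ⟨n⟩ : Nonempty N := by
        obtain ⟨⟨a⟩⟩ | ⟨⟨q, n, -⟩⟩ := hAB
        · exact ⟨a⟩
        · exact ⟨n⟩
      exact fun hbot => (hGmin n).2.1 (le_bot_iff.1 (hbot ▸ hGle n))
    · intro hne
      by_contra hAB
      have hN : IsEmpty N := ⟨fun n => by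
        obtain ⟨a | ⟨b, -⟩, -⟩ := hν.2 n
        · exact hAB (Or.inl ⟨a⟩)
        · exact hAB (Or.inr ⟨b⟩)⟩
      refine hne (hGsup.symm.trans ?_)
      rw [iSup_of_empty]
      exact IsClosed.submodule_topologicalClosure_eq (by simp)
  · simp only [hix]
    rw [hfam]
    refine isOrthogonalDecomposition_of_pairwise ?_ ?_ ?_
    · rintro (_ | k)
      · exact Submodule.isClosed_orthogonal _
      · exact (hGmin _).1.1
    · have hD : ∀ k, M.decaying ⟂ G (ν k) := fun k =>
        (Submodule.isOrtho_orthogonal_left _).mono_right (hGle _)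
      rintro (_ | k) (_ | l) hkl
      · exact absurd rfl hkl
      · exact hD l
      · exact (hD k).symm
      · exact hGpw fun h0 => hkl (congrArg Sum.inr (hν.1 h0))
    · rw [iSup_sum]
      simp only [Sum.elim_inl, Sum.elim_inr, Function.comp_apply, ciSup_const]
      -- The complement of everything is `Dᗮ ⊓ Rᗮ = Dᗮ ⊓ D`, which is zero.
      rw [show ⨆ k, G (ν k) = ⨆ n, G n from (Equiv.ofBijective ν hν).iSup_comp (g := G), ← Submodule.inf_orthogonal,
        ← Submodule.orthogonal_closure (⨆ n, G n), hGsup]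
      exact (inf_comm _ _).trans (Submodule.inf_orthogonal_eq_bot _)
  · intro a
    rw [hix]
    exact ⟨hGmin _, (hGmin _).isCommunicationClass⟩
  · intro b c
    rw [hix]
    exact ⟨hGmin _, (hGmin _).isCommunicationClass⟩
  · intro a W hW
    rw [hix]
    constructor
    · intro hn
      have h1 := hclass {a.1} W a.1 hW hn fun m hm => a.2 m hm
      have h2 : W ≤ G a.1 := h1.trans (Submodule.topologicalClosure_minimal _
        (iSup_le fun m => by rw [Set.mem_singleton_iff.1 m.2]) (hGmin _).1.1)
      exact ((hGmin a.1).2.2 W hW.1 h2).resolve_left hW.2.1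
    · rintro rfl hn
      exact (hGmin a.1).2.1 (Submodule.isOrtho_self.1 hn)
  · intro b c W hW hn
    rw [hix] at hn
    simp only [hix]
    exact hclass {n | Quotient.mk s n = b.1} W c.1 hW hn fun m hm =>
      (Quotient.sound hm).symm.trans c.2
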